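/- **Definitions.** Let $S$ be a left cancellative monoid with identity $e$. Its left inverse hull $I_\ell(S)$ is the inverse semigroup of partial bijections of $S$ generated by the left translations $t\mapsto st$, $s\in S$; we identify $s$ with the corresponding translation. Let $\mathcal J(S)$ be the collection of constructible right ideals, that is, of the sets $X\subseteq S$ such that the identity map $p_X$ of $X$ lies in $I_\ell(S)$, and let $\bar{\mathcal J}(S)$ be the collection of the sets $X\setminus\bigcup_{i=1}^m X_i$ with $m\ge 0$ and $X,X_1,\dots,X_m\in\mathcal J(S)$. The monoid $S$ is called *C\*-regular* if, whenever $h_1,\dots,h_n\in I_\ell(S)$ and $X\in\bar{\mathcal J}(S)$ satisfy $\emptyset\neq X\subseteq\bigcup_{k=1}^n\{s\in S: h_ks=s\}$, there are $Y_1,\dots,Y_l\in\bar{\mathcal J}(S)$ and indices $1\le k_j\le n$ such that $X\subseteq\bigcup_{j=1}^l Y_j$ and $h_{k_j}|_{Y_j}=\mathrm{id}$ for all $j$. Let $\Omega(S)$ be the closure of $\{\chi_s: s\in S\}$, where $\chi_s(p_X)=\mathbb 1_X(s)$, in the compact space of nonzero semigroup homomorphisms $\chi\colon\{p_X: X\in\mathcal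 J(S)\}\to\{0,1\}$ with the topology of pointwise convergence. The groupoid $\mathcal G(S)$ has unit space $\Omega(S)$ and consists of the classes $[g,\chi]$ of pairs $(g,\chi)\in I_\ell(S)\times\Omega(S)$ with $\chi(g^{-1}g)=1$, where $[g,\chi]=[h,\chi]$ if and only if there are $X,X_1,\dots,X_m\in\mathcal J(S)$ with $\chi(p_X)=1$ and $\chi(p_{X_i})=0$ for all $i$ such that $g=h$ on $X\setminus\bigcup_{i}X_i$. The source of $[g,\chi]$ is $\chi$, its range is $\chi(g^{-1}\cdot g)$, and $[h,\psi][g,\chi]=[hg,\chi]$ if $\psi=\chi(g^{-1}\cdot g)$. The sets $D(g,U)=\{[g,\chi]:\chi\in U\}$, for $g\in I_\ell(S)$ and $U$ an open subset of $\{\chi\in\Omega(S):\chi(g^{-1}g)=1\}$, form a basis of the topology of $\mathcal G(S)$. The C\*-algebra $C^*_r(\mathcal G(S))$ is the completion of the convolution algebra $C_c(\mathcal G(S))$ (the span of the spaces $C_c(V)$ for open Hausdorff subsets $V\subseteq\mathcal G(S)$, functions being extended by zero) with respect to the norm $\sup_{x\in\Omega(S)}\|\rho_x(f)\|$, where $\rho_x$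 is the representation on $\ell^2(\mathcal G(S)_x)$, $\mathcal G(S)_x$ being the set of arrows with source $x$, given by $(\rho_x(f)\xi)(g)=\sum_{r(h)=r(g)}f(h)\xi(h^{-1}g)$. The C\*-algebra $C^*_r(S)\subseteq B(\ell^2(S))$ is generated by the operators $\lambda_s\delta_t=\delta_{st}$, $s\in S$. Identifying $S$ with $\mathcal G(S)_{\chi_e}$ by the bijection $s\mapsto[s,\chi_e]$, one views $\rho_{\chi_e}$ as a representation of $C^*_r(\mathcal G(S))$ on $\ell^2(S)$. **Proposition.** Consider the monoid given by the presentation $$T=\langle a,b,c,x_n,y_n\ (n\in\mathbb Z):\ abx_n=bx_n,\ aby_n=by_{n+1},\ cbx_n=bx_{n+1},\ cby_n=by_n\ (n\in\mathbb Z)\rangle .$$ Then $T$ is left cancellative. It is not C\*-regular. Furthermore, $\rho_{\chi_e}$ defines a $*$-homomorphism $\rho_{\chi_e}\colon C^*_r(\mathcal G(T))\to C^*_r(T)$, and this homomorphism has nontrivial kernel: the right ideal $X=\bigcup_{n\in\mathbb Z}bx_nT\cup\bigcup_{n\in\mathbb Z}by_nT$ is constructible and, with $U=\{\eta\in\Omega(T):\eta(p_X)=1\}$,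 the element $$(\mathbb 1_{D(a,\Omega(T))}-\mathbb 1_{\Omega(T)})*(\mathbb 1_{D(c,\Omega(T))}-\mathbb 1_{\Omega(T)})*\mathbb 1_U\in C_c(\mathcal G(T))\subseteq C^*_r(\mathcal G(T))$$ is nonzero and lies in $\ker\rho_{\chi_e}$. -/

import Mathlib

noncomputable section

open CategoryTheory
open scoped ENNReal

namespace GpdCStar

/-- The Hilbert space `ℓ²(ι)`. -/
abbrev Ell2 (ι : Type*) : Type _ := lp (fun _ : ι => ℂ) 2

/-- The bounded operators on `ℓ²(ι)`. -/
abbrev BEll2 (ι : Type*) : Type _ := Ell2 ι →L[ℂ] Ell2 ι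

section Kernel

variable {ι : Type*}

/-- All row sums and all column sums of the matrix `(‖k i j‖)` are at most `C`. -/
def RowColBound (k : ι → ι → ℂ) (C : ℝ) : Prop :=
  (∀ (i : ι) (s : Finset ι), ∑ j ∈ s, ‖k i j‖ ≤ C) ∧
  (∀ (j : ι) (s : Finset ι), ∑ i ∈ s, ‖k i j‖ ≤ C)

variable {k : ι → ι → ℂ} {C : ℝ}

lemma sum_sq_le_norm_sq (ξ : Ell2 ι) (s : Finset ι) : ∑ j ∈ s, ‖ξ j‖ ^ 2 ≤ ‖ξ‖ ^ 2 := by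
  have h := lp.sum_rpow_le_norm_rpow (p := 2) (by norm_num) ξ s
  simpa using h

lemma RowColBound.nonneg (h : RowColBound k C) (i : ι) : 0 ≤ C := by
  simpa using h.1 i ∅

lemma RowColBound.summable_norm (h : RowColBound k C) (ξ : Ell2 ι) (i : ι) :
    Summable fun j => ‖k i j * ξ j‖ := by
  refine summable_of_sum_le (c := C * ‖ξ‖) (fun _ => norm_nonneg _) fun s => ?_
  calc ∑ j ∈ s, ‖k i j * ξ j‖ ≤ ∑ j ∈ s, ‖k i j‖ * ‖ξ‖ := by
        refine Finset.sum_le_sum fun j _ => ?_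
        rw [norm_mul]
        gcongr
        exact lp.norm_apply_le_norm (by norm_num) ξ j
    _ = (∑ j ∈ s, ‖k i j‖) * ‖ξ‖ := by rw [Finset.sum_mul]
    _ ≤ C * ‖ξ‖ := by gcongr; exact h.1 i s

lemma RowColBound.summable (h : RowColBound k C) (ξ : Ell2 ι) (i : ι) :
    Summable fun j => k i j * ξ j := (h.summable_norm ξ i).of_norm

lemma RowColBound.summable_sq (h : RowColBound k C) (ξ : Ell2 ι) (i : ι) :
    Summable fun j => ‖k i j‖ * ‖ξ j‖ ^ 2 := by
  refine summable_of_sum_le (c := C * ‖ξ‖ ^ 2) (fun _ => by positivity) fun s => ?_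
  calc ∑ j ∈ s, ‖k i j‖ * ‖ξ j‖ ^ 2 ≤ ∑ j ∈ s, ‖k i j‖ * ‖ξ‖ ^ 2 := by
        refine Finset.sum_le_sum fun j _ => ?_
        gcongr
        exact lp.norm_apply_le_norm (by norm_num) ξ j
    _ = (∑ j ∈ s, ‖k i j‖) * ‖ξ‖ ^ 2 := by rw [Finset.sum_mul]
    _ ≤ C * ‖ξ‖ ^ 2 := by gcongr; exact h.1 i s

lemma RowColBound.row (h : RowColBound k C) (ξ : Ell2 ι) (i : ι) :
    ‖∑' j, k i j * ξ j‖ ^ 2 ≤ C * ∑' j, ‖k i j‖ * ‖ξ j‖ ^ 2 := by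
  have hC := h.nonneg i
  have h1 : ‖∑' j, k i j * ξ j‖ ≤ ∑' j, ‖k i j * ξ j‖ := norm_tsum_le_tsum_norm (h.summable_norm ξ i)
  have h2 : ∑' j, ‖k i j * ξ j‖ ≤ √(C * ∑' j, ‖k i j‖ * ‖ξ j‖ ^ 2) := by
    refine (h.summable_norm ξ i).tsum_le_of_sum_le fun s => Real.le_sqrt_of_sq_le ?_
    calc (∑ j ∈ s, ‖k i j * ξ j‖) ^ 2
        ≤ (∑ j ∈ s, ‖k i j‖) * ∑ j ∈ s, ‖k i j‖ * ‖ξ j‖ ^ 2 := by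
          refine Finset.sum_sq_le_sum_mul_sum_of_sq_le_mul s (fun _ _ => by positivity)
            (fun _ _ => by positivity) fun j _ => ?_
          exact le_of_eq (by rw [norm_mul]; ring)
      _ ≤ C * ∑' j, ‖k i j‖ * ‖ξ j‖ ^ 2 := by
          gcongr
          · exact h.1 i s
          · exact (h.summable_sq ξ i).sum_le_tsum s fun _ _ => by positivity
  have h3 : 0 ≤ C * ∑' j, ‖k i j‖ * ‖ξ j‖ ^ 2 :=
    mul_nonneg hC (tsum_nonneg fun _ => by positivity)
  calc ‖∑' j, k i j * ξ j‖ ^ 2 ≤ √(C * ∑' j, ‖k i j‖ * ‖ξ j‖ ^ 2) ^ 2 := by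
        gcongr; exact h1.trans h2
    _ = _ := Real.sq_sqrt h3

lemma RowColBound.sum_le (h : RowColBound k C) (ξ : Ell2 ι) (s : Finset ι) :
    ∑ i ∈ s, ‖∑' j, k i j * ξ j‖ ^ 2 ≤ (C * ‖ξ‖) ^ 2 := by
  rcases s.eq_empty_or_nonempty with rfl | ⟨i₀, -⟩
  · simpa using sq_nonneg (C * ‖ξ‖)
  have hC := h.nonneg i₀
  calc ∑ i ∈ s, ‖∑' j, k i j * ξ j‖ ^ 2 ≤ ∑ i ∈ s, C * ∑' j, ‖k i j‖ * ‖ξ j‖ ^ 2 :=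
        Finset.sum_le_sum fun i _ => h.row ξ i
    _ = C * ∑' j, ∑ i ∈ s, ‖k i j‖ * ‖ξ j‖ ^ 2 := by
        rw [← Finset.mul_sum, Summable.tsum_finsetSum fun i _ => h.summable_sq ξ i]
    _ ≤ C * (C * ‖ξ‖ ^ 2) := by
        gcongr
        refine (summable_sum fun i _ => h.summable_sq ξ i).tsum_le_of_sum_le fun t => ?_
        calc ∑ j ∈ t, ∑ i ∈ s, ‖k i j‖ * ‖ξ j‖ ^ 2 = ∑ j ∈ t, (∑ i ∈ s, ‖k i j‖) * ‖ξ j‖ ^ 2 := by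
              simp_rw [Finset.sum_mul]
          _ ≤ ∑ j ∈ t, C * ‖ξ j‖ ^ 2 := by
              refine Finset.sum_le_sum fun j _ => ?_
              gcongr; exact h.2 j s
          _ = C * ∑ j ∈ t, ‖ξ j‖ ^ 2 := by rw [Finset.mul_sum]
          _ ≤ C * ‖ξ‖ ^ 2 := by gcongr; exact sum_sq_le_norm_sq ξ t
    _ = _ := by ring

/-- The bounded operator on `ℓ²(ι)` with matrix `k`, `(Tξ)(i) = ∑ⱼ k(i,j) ξ(j)`. -/
def kernelOp (k : ι → ι → ℂ) (C : ℝ) (h : RowColBound k C) : BEll2 ι :=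
  LinearMap.mkContinuous
    { toFun := fun ξ => ⟨fun i => ∑' j, k i j * ξ j, by
        refine memℓp_gen' (C := (C * ‖ξ‖) ^ 2) fun s => ?_
        simpa using h.sum_le ξ s⟩
      map_add' := fun ξ η => by
        ext i
        simp only [lp.coeFn_add, Pi.add_apply, mul_add]
        exact (h.summable ξ i).tsum_add (h.summable η i)
      map_smul' := fun c ξ => by
        ext i
        simp only [lp.coeFn_smul, Pi.smul_apply, smul_eq_mul, RingHom.id_apply]
        rw [← tsum_mul_left]
        exact tsum_congr fun j => by ring }
    |C| fun ξ => by
      refine lp.norm_le_of_forall_sum_le (by norm_num) (by positivity) fun s => ?_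
      have := h.sum_le ξ s
      rw [← sq_abs, abs_mul, abs_norm] at this
      simpa using this

lemma kernelOp_apply (h : RowColBound k C) (ξ : Ell2 ι) (i : ι) :
    kernelOp k C h ξ i = ∑' j, k i j * ξ j := rfl

lemma norm_kernelOp_le (h : RowColBound k C) : ‖kernelOp k C h‖ ≤ |C| :=
  LinearMap.mkContinuous_norm_le _ (abs_nonneg _) _

end Kernel

section Perm

variable {ι κ : Type*}

lemma memℓp_comp_injective {f : ι → κ} (hf : Function.Injective f) (ξ : Ell2 κ) :
    Memℓp (fun i => ξ (f i)) 2 := by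
  refine memℓp_gen' (C := ‖ξ‖ ^ 2) fun s => ?_
  have := sum_sq_le_norm_sq ξ (s.map ⟨f, hf⟩)
  simpa using this

/-- The unitary `ℓ²(ι) → ℓ²(κ)`, `δ_i ↦ δ_{e i}`, defined by a bijection `e : ι ≃ κ`. -/
def ell2Congr (e : ι ≃ κ) : Ell2 ι ≃ₗᵢ[ℂ] Ell2 κ where
  toFun ξ := ⟨fun j => ξ (e.symm j), memℓp_comp_injective e.symm.injective ξ⟩
  invFun ξ := ⟨fun i => ξ (e i), memℓp_comp_injective e.injective ξ⟩
  map_add' _ _ := rfl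
  map_smul' _ _ := rfl
  left_inv ξ := by ext i; simp
  right_inv ξ := by ext i; simp
  norm_map' ξ := by
    have h1 := lp.norm_rpow_eq_tsum (p := 2) (by norm_num) ξ
    have h2 := lp.norm_rpow_eq_tsum (p := 2) (E := fun _ : κ => ℂ) (by norm_num)
      ⟨fun j => ξ (e.symm j), memℓp_comp_injective e.symm.injective ξ⟩
    have h3 := e.symm.tsum_eq fun i => ‖ξ i‖ ^ (2 : ℝ≥0∞).toReal
    rw [h3, ← h1] at h2
    have h4 : ‖(⟨fun j => ξ (e.symm j), memℓp_comp_injective e.symm.injective ξ⟩ : Ell2 κ)‖ = ‖ξ‖ := by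
      simpa using h2
    exact h4

end Perm

section Product

variable {X : Type*} (A : X → Type*) [∀ x, NonUnitalCStarAlgebra (A x)]

/-- The C*-algebra of bounded families `(Tₓ)ₓ`, `Tₓ ∈ Aₓ`, with the norm `supₓ ‖Tₓ‖`. -/
abbrev CStarProd : Type _ := lp A ∞

/-- The coordinate maps. -/
def CStarProd.eval (x : X) : CStarProd A →⋆ₙₐ[ℂ] A x where
  toFun z := z x
  map_smul' _ _ := rfl
  map_zero' := rfl
  map_add' _ _ := rfl
  map_mul' _ _ := rfl
  map_star' _ := rfl

variable {A}

/-- A bounded family of elements, as an element of the product. -/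
def CStarProd.mk (T : ∀ x, A x) (C : ℝ) (hT : ∀ x, ‖T x‖ ≤ C) : CStarProd A :=
  ⟨T, memℓp_infty ⟨C, by rintro _ ⟨x, rfl⟩; exact hT x⟩⟩

end Product

section Groupoid

/-- The set of arrows of a groupoid `𝒢` with unit space `X`. -/
structure Arr (X : Type*) [Groupoid X] where
  /-- The source of the arrow. -/
  src : X
  /-- The range of the arrow. -/
  rng : X
  /-- The arrow itself. -/
  hom : src ⟶ rng

/-- The set `𝒢ₓ = s⁻¹(x)` of arrows with source `x`. -/
abbrev SrcFiber {X : Type*} [Groupoid X] (x : X) : Type _ := Σ y : X, (x ⟶ y)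

/-- The set `𝒢ʸ = r⁻¹(y)` of arrows with range `y`. -/
abbrev RngFiber {X : Type*} [Groupoid X] (y : X) : Type _ := Σ z : X, (z ⟶ y)

variable {X : Type*} [Groupoid X]

/-- The sums of `‖f‖` along the source and range fibres are at most `C`. -/
def FiberBound (f : Arr X → ℂ) (C : ℝ) : Prop :=
  (∀ (x : X) (s : Finset (SrcFiber x)), ∑ g ∈ s, ‖f ⟨x, g.1, g.2⟩‖ ≤ C) ∧
  (∀ (y : X) (s : Finset (RngFiber y)), ∑ g ∈ s, ‖f ⟨g.1, y, g.2⟩‖ ≤ C)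

/-- The matrix `(g, k) ↦ f(g k⁻¹)` on `𝒢ₓ`. -/
def regKernel (f : Arr X → ℂ) (x : X) (g k : SrcFiber x) : ℂ :=
  f ⟨k.1, g.1, Groupoid.inv k.2 ≫ g.2⟩

/-- The bijection `𝒢ₓ → 𝒢^{r(g)}`, `k ↦ g k⁻¹`. -/
def divEquiv {x : X} (g : SrcFiber x) : SrcFiber x ≃ RngFiber g.1 where
  toFun k := ⟨k.1, Groupoid.inv k.2 ≫ g.2⟩
  invFun h := ⟨h.1, g.2 ≫ Groupoid.inv h.2⟩
  left_inv k := by simp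
  right_inv h := by simp

/-- The bijection `𝒢ₓ → 𝒢_{r(k)}`, `g ↦ g k⁻¹`. -/
def mulInvEquiv {x : X} (k : SrcFiber x) : SrcFiber x ≃ SrcFiber k.1 where
  toFun g := ⟨g.1, Groupoid.inv k.2 ≫ g.2⟩
  invFun h := ⟨h.1, k.2 ≫ h.2⟩
  left_inv g := by simp
  right_inv h := by simp

lemma FiberBound.rowColBound {f : Arr X → ℂ} {C : ℝ} (h : FiberBound f C) (x : X) :
    RowColBound (regKernel f x) C := by
  refine ⟨fun g s => ?_, fun k s => ?_⟩
  · have := h.2 g.1 (s.map (divEquiv g).toEmbedding)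
    simpa [regKernel, divEquiv] using this
  · have := h.1 k.1 (s.map (mulInvEquiv k).toEmbedding)
    simpa [regKernel, mulInvEquiv] using this

variable (X) [TopologicalSpace (Arr X)]

/-- Every arrow has an open neighbourhood on which the source and range maps are injective, as is
the case when these maps are local homeomorphisms. This is what makes the operators `ρₓ(f)` bounded
for all `f ∈ C_c(𝒢)`. -/
class HasOpenBisections : Prop where
  exists_bisection : ∀ γ : Arr X, ∃ V : Set (Arr X),
    IsOpen V ∧ γ ∈ V ∧ Set.InjOn Arr.src V ∧ Set.InjOn Arr.rng V

/-- `f` is (the extension by zero of) a continuous compactly supported function on some open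
Hausdorff subset `V` of `𝒢`. -/
def IsBasicCc (f : Arr X → ℂ) : Prop :=
  ∃ V : Set (Arr X), IsOpen V ∧ T2Space V ∧ ContinuousOn f V ∧
    ∃ K : Set (Arr X), IsCompact K ∧ K ⊆ V ∧ ∀ γ, γ ∉ K → f γ = 0

/-- The space `C_c(𝒢)` of a not necessarily Hausdorff groupoid `𝒢`: the span of the spaces
`C_c(V)` for the open Hausdorff subsets `V ⊆ 𝒢`. -/
def Cc : Submodule ℂ (Arr X → ℂ) := Submodule.span ℂ {f | IsBasicCc X f}

variable {X}

lemma sum_le_of_cover {α ι : Type*} (F : α → ℝ) (hF : ∀ a, 0 ≤ F a) (M : ℝ) (hM : 0 ≤ M)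
    (hFM : ∀ a, F a ≤ M) (t : Finset ι) (P : ι → α → Prop)
    (hP : ∀ i a b, P i a → P i b → a = b) (hcov : ∀ a, F a ≠ 0 → ∃ i ∈ t, P i a) (s : Finset α) :
    ∑ a ∈ s, F a ≤ t.card * M := by
  classical
  calc ∑ a ∈ s, F a ≤ ∑ a ∈ s, ∑ i ∈ t, (if P i a then F a else 0) := by
        refine Finset.sum_le_sum fun a _ => ?_
        by_cases h : F a = 0
        · rw [h]; exact Finset.sum_nonneg fun i _ => by split_ifs <;> simp
        · obtain ⟨i, hi, hPi⟩ := hcov a h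
          refine le_trans ?_ (Finset.single_le_sum (fun j _ => ?_) hi)
          · rw [if_pos hPi]
          · split_ifs
            · exact hF a
            · exact le_rfl
    _ = ∑ i ∈ t, ∑ a ∈ s, (if P i a then F a else 0) := Finset.sum_comm
    _ ≤ ∑ i ∈ t, M := by
        refine Finset.sum_le_sum fun i _ => ?_
        by_cases h : ∃ a ∈ s, P i a
        · obtain ⟨a, ha, hPa⟩ := h
          rw [Finset.sum_eq_single a]
          · rw [if_pos hPa]; exact hFM a
          · intro b _ hb
            rw [if_neg fun hPb => hb (hP i b a hPb hPa)]
          · exact fun h => absurd ha h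
        · push Not at h
          rw [Finset.sum_eq_zero fun a ha => if_neg (h a ha)]
          exact hM
    _ = t.card * M := by simp

lemma IsBasicCc.exists_fiberBound [HasOpenBisections X] {f : Arr X → ℂ} (hf : IsBasicCc X f) :
    ∃ C, FiberBound f C := by
  obtain ⟨V, -, -, hc, K, hK, hKV, h0⟩ := hf
  obtain ⟨M, hM⟩ := hK.exists_bound_of_continuousOn (hc.mono hKV)
  choose B hBo hBm hBs hBr using HasOpenBisections.exists_bisection (X := X)
  obtain ⟨t, ht⟩ := hK.elim_finite_subcover B hBo fun γ _ => Set.mem_iUnion.2 ⟨γ, hBm γ⟩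
  have hFM : ∀ γ, ‖f γ‖ ≤ max M 0 := fun γ => by
    by_cases h : γ ∈ K
    · exact (hM γ h).trans (le_max_left _ _)
    · rw [h0 γ h]; simp
  have hcov : ∀ γ, ‖f γ‖ ≠ 0 → ∃ i ∈ t, γ ∈ B i := fun γ h => by
    have : γ ∈ K := by_contra fun hK => h (by rw [h0 γ hK, norm_zero])
    simpa using ht this
  refine ⟨t.card * max M 0, fun x s => ?_, fun y s => ?_⟩
  · refine sum_le_of_cover (fun g : SrcFiber x => ‖f ⟨x, g.1, g.2⟩‖) (fun _ => norm_nonneg _) _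
      (le_max_right _ _) (fun _ => hFM _) t (fun i g => (⟨x, g.1, g.2⟩ : Arr X) ∈ B i)
      (fun i g h hg hh => ?_) (fun g hg => hcov _ hg) s
    obtain ⟨y, g⟩ := g
    obtain ⟨z, h⟩ := h
    have := hBs i hg hh rfl
    simpa using this
  · refine sum_le_of_cover (fun g : RngFiber y => ‖f ⟨g.1, y, g.2⟩‖) (fun _ => norm_nonneg _) _
      (le_max_right _ _) (fun _ => hFM _) t (fun i g => (⟨g.1, y, g.2⟩ : Arr X) ∈ B i)
      (fun i g h hg hh => ?_) (fun g hg => hcov _ hg) s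
    obtain ⟨x, g⟩ := g
    obtain ⟨z, h⟩ := h
    have := hBr i hg hh rfl
    simp only [Arr.mk.injEq] at this
    obtain ⟨rfl, -, h⟩ := this
    simpa using h

lemma exists_fiberBound [HasOpenBisections X] {f : Arr X → ℂ} (hf : f ∈ Cc X) :
    ∃ C, FiberBound f C := by
  induction hf using Submodule.span_induction with
  | mem f hf => exact IsBasicCc.exists_fiberBound hf
  | zero => exact ⟨0, by simp [FiberBound]⟩
  | add f g _ _ hf hg =>
    obtain ⟨C, hC⟩ := hf
    obtain ⟨D, hD⟩ := hg
    refine ⟨C + D, fun x s => ?_, fun x s => ?_⟩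
    · refine (Finset.sum_le_sum fun _ _ => norm_add_le _ _).trans ?_
      rw [Finset.sum_add_distrib]
      exact add_le_add (hC.1 x s) (hD.1 x s)
    · refine (Finset.sum_le_sum fun _ _ => norm_add_le _ _).trans ?_
      rw [Finset.sum_add_distrib]
      exact add_le_add (hC.2 x s) (hD.2 x s)
  | smul c f _ hf =>
    obtain ⟨C, hC⟩ := hf
    refine ⟨‖c‖ * C, fun x s => ?_, fun x s => ?_⟩
    · simp only [Pi.smul_apply, norm_smul, ← Finset.mul_sum]
      exact mul_le_mul_of_nonneg_left (hC.1 x s) (norm_nonneg c)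
    · simp only [Pi.smul_apply, norm_smul, ← Finset.mul_sum]
      exact mul_le_mul_of_nonneg_left (hC.2 x s) (norm_nonneg c)

variable [HasOpenBisections X]

/-- The operator `ρₓ(f)` on `ℓ²(𝒢ₓ)`; see `regOp_apply` for the formula. -/
def regOp (f : Cc X) (x : X) : BEll2 (SrcFiber x) :=
  kernelOp (regKernel f.1 x) (exists_fiberBound f.2).choose
    ((exists_fiberBound f.2).choose_spec.rowColBound x)

/-- `(ρₓ(f)ξ)(g) = ∑_{h ∈ 𝒢^{r(g)}} f(h) ξ(h⁻¹g)`. -/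
lemma regOp_apply (f : Cc X) (x : X) (ξ : Ell2 (SrcFiber x)) (g : SrcFiber x) :
    regOp f x ξ g =
      ∑' h : RngFiber g.1, f.1 ⟨h.1, g.1, h.2⟩ * ξ ⟨h.1, g.2 ≫ Groupoid.inv h.2⟩ := by
  rw [regOp, kernelOp_apply, ← (divEquiv g).symm.tsum_eq]
  refine tsum_congr fun h => ?_
  simp [regKernel, divEquiv]

variable (X) in
/-- The C*-algebra `∏ₓ B(ℓ²(𝒢ₓ))` of bounded families of operators, with the norm
`‖(Tₓ)ₓ‖ = supₓ ‖Tₓ‖`. -/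
def RegAmbient : Type _ := CStarProd fun x : X => BEll2 (SrcFiber x)

instance : NonUnitalCStarAlgebra (RegAmbient X) :=
  inferInstanceAs (NonUnitalCStarAlgebra (CStarProd fun x : X => BEll2 (SrcFiber x)))

variable (X) in
/-- The coordinate map `∏ₓ B(ℓ²(𝒢ₓ)) → B(ℓ²(𝒢ₓ))`. -/
def RegAmbient.eval (x : X) : RegAmbient X →⋆ₙₐ[ℂ] BEll2 (SrcFiber x) :=
  CStarProd.eval (fun x : X => BEll2 (SrcFiber x)) x

/-- The family `(ρₓ(f))ₓ`; its norm is the reduced norm `‖f‖ᵣ = supₓ ‖ρₓ(f)‖`. -/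
def regFamily (f : Cc X) : RegAmbient X :=
  CStarProd.mk (fun x => regOp f x) |(exists_fiberBound f.2).choose| fun _ => norm_kernelOp_le _

variable (X) in
/-- The reduced C*-algebra `C*_r(𝒢)`: the completion of the `*`-algebra `C_c(𝒢)` with respect to
the norm `‖f‖ᵣ = supₓ ‖ρₓ(f)‖`, realized as the closed `*`-subalgebra of `∏ₓ B(ℓ²(𝒢ₓ))` generated
by the image of `C_c(𝒢)`. -/
def ReducedCStar : NonUnitalStarSubalgebra ℂ (RegAmbient X) :=
  (NonUnitalStarAlgebra.adjoin ℂ (Set.range (regFamily (X := X)))).topologicalClosure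

/-- The canonical map `C_c(𝒢) → C*_r(𝒢)`. -/
def toReduced (f : Cc X) : ReducedCStar X :=
  ⟨regFamily f, NonUnitalStarSubalgebra.le_topologicalClosure _
    (NonUnitalStarAlgebra.subset_adjoin ℂ _ ⟨f, rfl⟩)⟩

/-- The extension of the representation `ρₓ` to `C*_r(𝒢)`. -/
def rho (x : X) : ReducedCStar X →⋆ₙₐ[ℂ] BEll2 (SrcFiber x) :=
  (RegAmbient.eval X x).comp (NonUnitalStarSubalgebraClass.subtype (ReducedCStar X))

lemma rho_toReduced (f : Cc X) (x : X) : rho x (toReduced f) = regOp f x := rfl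

end Groupoid

end GpdCStar

namespace LeftCancelMonoidGpd

open GpdCStar

section Hull

variable {S : Type*} [Monoid S] [IsLeftCancelMul S]

open scoped Classical in
/-- The left translation `t ↦ st`, as a partial bijection of `S` with domain `S` and range `sS`. -/
def leftTrans (s : S) : S ≃. S where
  toFun t := some (s * t)
  invFun u := if h : ∃ t, s * t = u then some h.choose else none
  inv t u := by
    constructor
    · intro h
      split_ifs at h with hu
      · obtain rfl := Option.some.inj h
        rw [hu.choose_spec]
    · intro h
      obtain rfl := Option.some.inj h
      have hu : ∃ t', s * t' = s * t := ⟨t, rfl⟩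
      rw [dif_pos hu, mul_left_cancel hu.choose_spec]

@[simp] lemma leftTrans_apply (s t : S) : leftTrans s t = some (s * t) := rfl

variable (S) in
/-- Membership in the left inverse hull `I_ℓ(S)`: the inverse semigroup of partial bijections of
`S` generated by the left translations. The product `gh` (first `h`, then `g`) is `h.trans g`. -/
inductive InHull : (S ≃. S) → Prop
  | of (s : S) : InHull (leftTrans s)
  | inv {g : S ≃. S} : InHull g → InHull g.symm
  | mul {g h : S ≃. S} : InHull g → InHull h → InHull (h.trans g)

variable (S) in
/-- The left inverse hull `I_ℓ(S)`. -/
abbrev Hull : Type _ := {g : S ≃. S // InHull S g}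

open scoped Classical in
variable (S) in
/-- A subset `X ⊆ S` is a constructible (right) ideal if the identity map `p_X` of `X` belongs to
`I_ℓ(S)`. The idempotents of `I_ℓ(S)` are exactly the maps `p_X`, so `X ↦ p_X` is the isomorphism
`𝒥(S) ≅ E(S)`. -/
def IsConstructible (X : Set S) : Prop := InHull S (PEquiv.ofSet X)

variable (S) in
/-- The collection `𝒥(S)` of constructible ideals. -/
abbrev CIdeal : Type _ := {X : Set S // IsConstructible S X}

open scoped Classical in
lemma IsConstructible.of_inHull {g : S ≃. S} (hg : InHull S g) (X : Set S)
    (h : ∀ s t, g s = some t ↔ s = t ∧ s ∈ X) : IsConstructible S X := by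
  have : PEquiv.ofSet X = g := by
    ext s t
    simp only [h, PEquiv.ofSet_eq_some_iff]
    constructor
    · rintro ⟨rfl, h⟩; exact ⟨rfl, h⟩
    · rintro ⟨rfl, h⟩; exact ⟨rfl, h⟩
  rw [IsConstructible, this]
  exact hg

open scoped Classical in
/-- The intersection of constructible ideals. -/
def CIdeal.inter (X Y : CIdeal S) : CIdeal S :=
  ⟨X.1 ∩ Y.1, IsConstructible.of_inHull (.mul Y.2 X.2) _ fun s t => by
    simp only [PEquiv.trans_eq_some, PEquiv.ofSet_eq_some_iff, Set.mem_inter_iff]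
    grind⟩

/-- The domain of `g ∈ I_ℓ(S)`; the corresponding idempotent is `g⁻¹g`. -/
def Hull.dom (g : Hull S) : CIdeal S :=
  ⟨{s | ∃ t, g.1 s = some t}, IsConstructible.of_inHull (.mul (.inv g.2) g.2) _ fun s t => by
    simp only [PEquiv.trans_eq_some, PEquiv.eq_some_iff, Set.mem_ofPred_eq]
    constructor
    · rintro ⟨u, h1, h2⟩; exact ⟨g.1.inj h1 h2, u, h1⟩
    · rintro ⟨rfl, u, h⟩; exact ⟨u, h, h⟩⟩

open scoped Classical in
/-- The preimage `g⁻¹(X)`; the corresponding idempotent is `g⁻¹ p_X g`. -/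
def Hull.preim (g : Hull S) (X : CIdeal S) : CIdeal S :=
  ⟨{s | ∃ t ∈ X.1, g.1 s = some t},
    IsConstructible.of_inHull (.mul (.inv g.2) (.mul X.2 g.2)) _ fun s t => by
    simp only [PEquiv.trans_eq_some, PEquiv.eq_some_iff, PEquiv.ofSet_eq_some_iff,
      Set.mem_ofPred_eq]
    constructor
    · rintro ⟨u, ⟨v, h1, rfl, h3⟩, h2⟩; exact ⟨g.1.inj h1 h2, u, h3, h1⟩
    · rintro ⟨rfl, u, hX, h⟩; exact ⟨u, ⟨u, h, rfl, hX⟩, h⟩⟩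

/-- The element `s ∈ S` viewed as an element of `I_ℓ(S)`. -/
def Hull.of (s : S) : Hull S := ⟨leftTrans s, .of s⟩

/-- The inverse in `I_ℓ(S)`. -/
def Hull.inv (g : Hull S) : Hull S := ⟨g.1.symm, .inv g.2⟩

/-- The product `gh` in `I_ℓ(S)`. -/
def Hull.mul (g h : Hull S) : Hull S := ⟨h.1.trans g.1, .mul g.2 h.2⟩

variable (S) in
/-- The collection `𝒥̄(S)` of the sets `X \ (X₁ ∪ ⋯ ∪ Xₘ)` with `X, X₁, …, Xₘ ∈ 𝒥(S)`, `m ≥ 0`. -/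
def IsBarConstructible (Z : Set S) : Prop :=
  ∃ (X : CIdeal S) (F : Set (CIdeal S)), F.Finite ∧ Z = X.1 \ ⋃ Y ∈ F, Y.1

variable (S) in
/-- `S` is C*-regular: whenever `h₁, …, hₙ ∈ I_ℓ(S)` and `X ∈ 𝒥̄(S)` satisfy
`∅ ≠ X ⊆ ⋃ₖ {s : hₖ s = s}`, there are `Y₁, …, Y_l ∈ 𝒥̄(S)` and indices `k₁, …, k_l` with
`X ⊆ ⋃ⱼ Yⱼ` and `h_{kⱼ}|_{Yⱼ} = id` for all `j`. -/
def IsCStarRegular : Prop :=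
  ∀ (n : ℕ) (h : Fin n → Hull S) (X : Set S), IsBarConstructible S X → X.Nonempty →
    (X ⊆ ⋃ k, {s | (h k).1 s = some s}) →
    ∃ (l : ℕ) (Y : Fin l → Set S) (κ : Fin l → Fin n),
      (∀ j, IsBarConstructible S (Y j)) ∧ (X ⊆ ⋃ j, Y j) ∧
      ∀ j, ∀ s ∈ Y j, (h (κ j)).1 s = some s

end Hull

section Spectrum

variable (S : Type*) [Monoid S] [IsLeftCancelMul S]

/-- The space `Ê(S)` of semi-characters of `E(S) ≅ 𝒥(S)`, that is, of nonzero semigroup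
homomorphisms to `{0,1}`, with the topology of pointwise convergence. -/
abbrev SemiChar : Type _ :=
  {χ : CIdeal S → Bool // (∃ X, χ X = true) ∧ ∀ X Y, χ (X.inter Y) = (χ X && χ Y)}

variable {S}

open scoped Classical in
/-- The semi-character `χ_s(p_X) = 𝟙_X(s)`. -/
def pointChar (s : S) : SemiChar S :=
  ⟨fun X => decide (s ∈ X.1),
    ⟨(Hull.of 1).dom, by simp [Hull.dom, Hull.of]⟩, fun X Y => by simp [CIdeal.inter]⟩

variable (S) in
/-- `Ω(S)`, the closure of the orbit `{χ_s : s ∈ S}` of `χ_e` in `Ê(S)`. -/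
def Omega : Type _ := {χ : SemiChar S // χ ∈ closure (Set.range (pointChar (S := S)))}

instance : TopologicalSpace (Omega S) := instTopologicalSpaceSubtype

/-- The value `χ(p_X)` of `χ ∈ Ω(S)`. -/
def Omega.eval (χ : Omega S) (X : CIdeal S) : Bool := χ.1.1 X

instance : CoeFun (Omega S) fun _ => CIdeal S → Bool := ⟨Omega.eval⟩

/-- The point `χ_s ∈ Ω(S)`. -/
def Omega.pt (s : S) : Omega S := ⟨pointChar s, subset_closure ⟨s, rfl⟩⟩

@[ext] lemma Omega.ext {χ ψ : Omega S} (h : ∀ X, χ X = ψ X) : χ = ψ :=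
  Subtype.ext (Subtype.ext (funext h))

lemma Omega.map_inter (χ : Omega S) (X Y : CIdeal S) : χ (X.inter Y) = (χ X && χ Y) :=
  χ.1.2.2 X Y

lemma Omega.pt_eq_true {s : S} {X : CIdeal S} : Omega.pt s X = true ↔ s ∈ X.1 := by
  classical exact decide_eq_true_iff

/-- The extension of `χ ∈ Ω(S)` to `𝒥̄(S)`: `χ(p_Z) = 1` for `Z = X \ (X₁ ∪ ⋯ ∪ Xₘ)` if
`χ(p_X) = 1` and `χ(p_{Xᵢ}) = 0` for all `i`. -/
def Omega.BarOne (χ : Omega S) (Z : Set S) : Prop :=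
  ∃ (X : CIdeal S) (F : Set (CIdeal S)), F.Finite ∧ Z = X.1 \ ⋃ Y ∈ F, Y.1 ∧
    χ X = true ∧ ∀ Y ∈ F, χ Y = false

lemma Omega.BarOne.inter {χ : Omega S} {Z W : Set S} (hZ : χ.BarOne Z) (hW : χ.BarOne W) :
    χ.BarOne (Z ∩ W) := by
  obtain ⟨X, F, hF, rfl, hX, hF0⟩ := hZ
  obtain ⟨Y, G, hG, rfl, hY, hG0⟩ := hW
  refine ⟨X.inter Y, F ∪ G, hF.union hG, ?_, ?_, ?_⟩
  · ext s
    simp only [CIdeal.inter, Set.mem_inter_iff, Set.mem_sdiff, Set.mem_iUnion, Set.mem_union]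
    grind
  · rw [χ.map_inter, hX, hY]; rfl
  · rintro Y (h | h)
    · exact hF0 Y h
    · exact hG0 Y h

lemma Omega.barOne_of {χ : Omega S} {X : CIdeal S} (h : χ X = true) : χ.BarOne X.1 :=
  ⟨X, ∅, Set.finite_empty, by simp, h, by simp⟩

end Spectrum
section Germs

variable {S : Type*} [Monoid S] [IsLeftCancelMul S]

lemma continuous_eval (X : CIdeal S) : Continuous fun χ : SemiChar S => χ.1 X :=
  (continuous_apply X).comp continuous_subtype_val

lemma act_mem_closure (g : Hull S) (χ : Omega S) (h : χ g.dom = true)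
    (h' : (∃ X, χ (g.preim X) = true) ∧
      ∀ X Y, χ (g.preim (X.inter Y)) = (χ (g.preim X) && χ (g.preim Y))) :
    (⟨fun X => χ (g.preim X), h'⟩ : SemiChar S) ∈ closure (Set.range (pointChar (S := S))) := by
  rw [closure_subtype]
  have hU : IsOpen {ψ : SemiChar S | ψ.1 g.dom = true} :=
    (isOpen_discrete {true}).preimage (continuous_eval g.dom)
  have h1 : χ.1 ∈ closure (Set.range (pointChar (S := S)) ∩ {ψ : SemiChar S | ψ.1 g.dom = true}) := by
    rw [Set.inter_comm]
    exact hU.inter_closure ⟨h, χ.2⟩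
  have hc : Continuous fun ψ : SemiChar S => (fun X => ψ.1 (g.preim X) : CIdeal S → Bool) :=
    continuous_pi fun X => continuous_eval _
  refine map_mem_closure (f := fun ψ : SemiChar S => (fun X => ψ.1 (g.preim X) : CIdeal S → Bool))
    hc h1 ?_
  rintro _ ⟨⟨s, rfl⟩, hs⟩
  obtain ⟨t, ht⟩ : s ∈ g.dom.1 := by
    classical exact decide_eq_true_iff.1 hs
  refine ⟨pointChar t, ⟨t, rfl⟩, ?_⟩
  funext X
  simp only [pointChar, Hull.preim]
  congr 1
  simp [ht]

/-- The action `χ ↦ χ(g⁻¹ · g)` of `g ∈ I_ℓ(S)` on the `χ ∈ Ω(S)` with `χ(g⁻¹g) = 1`. -/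
def Omega.act (g : Hull S) (χ : Omega S) (h : χ g.dom = true) : Omega S :=
  have h' : (∃ X, χ (g.preim X) = true) ∧
      ∀ X Y, χ (g.preim (X.inter Y)) = (χ (g.preim X) && χ (g.preim Y)) := by
    refine ⟨⟨(Hull.of 1).dom, ?_⟩, fun X Y => ?_⟩
    · rw [← h]
      congr 1
      ext s
      simp [Hull.preim, Hull.dom, Hull.of]
    · rw [← χ.map_inter]
      congr 1
      ext s
      simp only [Hull.preim, CIdeal.inter, Set.mem_ofPred_eq, Set.mem_inter_iff]
      grind
  ⟨⟨fun X => χ (g.preim X), h'⟩, act_mem_closure g χ h h'⟩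

lemma Omega.act_apply (g : Hull S) (χ : Omega S) (h : χ g.dom = true) (X : CIdeal S) :
    χ.act g h X = χ (g.preim X) := rfl

/-- The elements `g ∈ I_ℓ(S)` with `χ(g⁻¹g) = 1`. -/
abbrev Hull.At (χ : Omega S) : Type _ := {g : Hull S // χ g.dom = true}

/-- `(g, χ) ∼ (h, χ)` if `g` and `h` coincide on some `Z ∈ 𝒥̄(S)` with `χ(p_Z) = 1`. -/
def germRel (χ : Omega S) (g h : Hull.At χ) : Prop :=
  ∃ Z, χ.BarOne Z ∧ ∀ s ∈ Z, g.1.1 s = h.1.1 s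

/-- The equivalence relation `∼` on the pairs `(g, χ)` with fixed `χ`. -/
def germSetoid (χ : Omega S) : Setoid (Hull.At χ) where
  r := germRel χ
  iseqv :=
    { refl := fun g => ⟨_, Omega.barOne_of g.2, fun _ _ => rfl⟩
      symm := fun ⟨Z, hZ, h⟩ => ⟨Z, hZ, fun s hs => (h s hs).symm⟩
      trans := fun ⟨_, hZ, h⟩ ⟨_, hW, h'⟩ =>
        ⟨_, hZ.inter hW, fun s hs => (h s hs.1).trans (h' s hs.2)⟩ }

/-- The classes `[g, χ]` with fixed `χ`. -/
abbrev Germ (χ : Omega S) : Type _ := Quotient (germSetoid χ)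

/-- The class `[g, χ]`. -/
def Germ.mk {χ : Omega S} (g : Hull S) (hg : χ g.dom = true) : Germ χ :=
  Quotient.mk (germSetoid χ) ⟨g, hg⟩

lemma Germ.mk_eq {χ : Omega S} {g h : Hull S} {hg : χ g.dom = true} {hh : χ h.dom = true} :
    Germ.mk g hg = Germ.mk h hh ↔ ∃ Z, χ.BarOne Z ∧ ∀ s ∈ Z, g.1 s = h.1 s :=
  ⟨fun h => Quotient.exact h, fun h => Quotient.sound h⟩

lemma Omega.exists_pt (χ : Omega S) {F : Set (CIdeal S)} (hF : F.Finite) :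
    ∃ s, ∀ X ∈ F, χ X = Omega.pt s X := by
  have hU : IsOpen {ψ : SemiChar S | ∀ X ∈ F, ψ.1 X = χ X} := by
    have : {ψ : SemiChar S | ∀ X ∈ F, ψ.1 X = χ X} =
        ⋂ X ∈ F, {ψ : SemiChar S | ψ.1 X = χ X} := by ext; simp
    rw [this]
    exact hF.isOpen_biInter fun X _ => (isOpen_discrete {χ X}).preimage (continuous_eval X)
  obtain ⟨_, h, s, rfl⟩ := mem_closure_iff.1 χ.2 _ hU fun _ _ => rfl
  exact ⟨s, fun X hX => (h X hX).symm⟩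

lemma germRel.act_eq {χ : Omega S} {g h : Hull.At χ} (hgh : germRel χ g h) :
    χ.act g.1 g.2 = χ.act h.1 h.2 := by
  obtain ⟨_, ⟨X, F, hF, rfl, hX, hF0⟩, H⟩ := hgh
  ext Y
  simp only [Omega.act_apply]
  obtain ⟨s, hs⟩ := χ.exists_pt (F := F ∪ {X, g.1.preim Y, h.1.preim Y}) (hF.union (by simp))
  have h1 : s ∈ X.1 := Omega.pt_eq_true.1 (by rw [← hs X (by simp), hX])
  have h2 : ∀ Z ∈ F, s ∉ Z.1 := fun Z hZ hsZ => by
    have := hs Z (Or.inl hZ)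
    rw [hF0 Z hZ, Omega.pt_eq_true.2 hsZ] at this
    exact absurd this (by simp)
  have h3 := H s ⟨h1, by simpa using h2⟩
  rw [hs (g.1.preim Y) (by simp), hs (h.1.preim Y) (by simp), Bool.eq_iff_iff,
    Omega.pt_eq_true, Omega.pt_eq_true]
  simp [Hull.preim, h3]

/-- The range `χ(g⁻¹ · g)` of `[g, χ]`. -/
def Germ.rng {χ : Omega S} (γ : Germ χ) : Omega S :=
  Quotient.lift (fun g : Hull.At χ => χ.act g.1 g.2) (fun _ _ h => germRel.act_eq h) γ

lemma Omega.BarOne.preim {χ : Omega S} {g : Hull S} (hg : χ g.dom = true) {Z : Set S}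
    (hZ : (χ.act g hg).BarOne Z) : χ.BarOne {s | ∃ t ∈ Z, g.1 s = some t} := by
  obtain ⟨X, F, hF, rfl, hX, hF0⟩ := hZ
  refine ⟨g.preim X, g.preim '' F, hF.image _, ?_, hX, ?_⟩
  · ext s
    simp only [Hull.preim, Set.mem_sdiff, Set.mem_iUnion, Set.mem_ofPred_eq, Set.mem_image,
      Set.biUnion_image]
    constructor
    · rintro ⟨t, ⟨hX, hF⟩, h⟩
      refine ⟨⟨t, hX, h⟩, ?_⟩
      rintro ⟨Y, hY, u, hu, h'⟩
      obtain rfl : t = u := Option.some.inj (h.symm.trans h')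
      exact hF ⟨Y, hY, hu⟩
    · rintro ⟨⟨t, hX, h⟩, hF⟩
      exact ⟨t, ⟨hX, fun ⟨Y, hY, hu⟩ => hF ⟨Y, hY, t, hu, h⟩⟩, h⟩
  · rintro _ ⟨Y, hY, rfl⟩
    exact hF0 Y hY

lemma Hull.dom_mul {χ : Omega S} {g h : Hull S} (hg : χ g.dom = true)
    (hh : χ.act g hg h.dom = true) : χ (h.mul g).dom = true := by
  rw [Omega.act_apply] at hh
  rw [← hh]
  congr 1
  ext s
  simp only [Hull.dom, Hull.preim, Hull.mul, Set.mem_ofPred_eq, PEquiv.trans_eq_some]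
  grind

lemma Omega.act_mul {χ : Omega S} {g h : Hull S} (hg : χ g.dom = true)
    (hh : χ.act g hg h.dom = true) :
    χ.act (h.mul g) (Hull.dom_mul hg hh) = (χ.act g hg).act h hh := by
  ext X
  simp only [Omega.act_apply]
  congr 1
  ext s
  simp only [Hull.preim, Hull.mul, Set.mem_ofPred_eq, PEquiv.trans_eq_some]
  grind

lemma Hull.dom_inv {χ : Omega S} {g : Hull S} (hg : χ g.dom = true) :
    χ.act g hg g.inv.dom = true := by
  rw [Omega.act_apply, ← hg]
  congr 1
  ext s
  simp only [Hull.preim, Hull.dom, Hull.inv, Set.mem_ofPred_eq, PEquiv.eq_some_iff]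
  grind

lemma Omega.act_inv {χ : Omega S} {g : Hull S} (hg : χ g.dom = true) :
    (χ.act g hg).act g.inv (Hull.dom_inv hg) = χ := by
  ext X
  simp only [Omega.act_apply]
  have : g.preim (g.inv.preim X) = X.inter g.dom := by
    ext s
    simp only [Hull.preim, Hull.dom, Hull.inv, CIdeal.inter, Set.mem_ofPred_eq,
      PEquiv.eq_some_iff, Set.mem_inter_iff]
    constructor
    · rintro ⟨t, ⟨u, hu, h1⟩, h2⟩
      obtain rfl := g.1.inj h1 h2
      exact ⟨hu, t, h2⟩
    · rintro ⟨hX, t, ht⟩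
      exact ⟨t, ⟨s, hX, ht⟩, ht⟩
  rw [this, χ.map_inter, hg, Bool.and_true]

lemma Omega.dom_one (χ : Omega S) : χ (Hull.of (1 : S)).dom = true := by
  obtain ⟨X, hX⟩ := χ.1.2.1
  have h := χ.map_inter X (Hull.of (1 : S)).dom
  have h2 : X.inter (Hull.of (1 : S)).dom = X := by
    ext s
    simp [CIdeal.inter, Hull.dom, Hull.of]
  rw [h2, show χ X = true from hX] at h
  simpa using h.symm

lemma Omega.act_one (χ : Omega S) : χ.act (Hull.of 1) χ.dom_one = χ := by
  ext X
  rw [Omega.act_apply]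
  congr 1
  ext s
  simp [Hull.preim, Hull.of]

/-- The arrows of `𝒢(S)` from `χ` to `ψ`: the classes `[g, χ]` with `χ(g⁻¹ · g) = ψ`. -/
abbrev GHom (χ ψ : Omega S) : Type _ := {γ : Germ χ // γ.rng = ψ}

/-- The arrow `[g, χ]`. -/
def GHom.mk {χ ψ : Omega S} (g : Hull S) (hg : χ g.dom = true) (h : χ.act g hg = ψ) : GHom χ ψ :=
  ⟨Germ.mk g hg, h⟩

lemma GHom.ind {χ ψ : Omega S} {P : GHom χ ψ → Prop} (h : ∀ g hg h, P (GHom.mk g hg h))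
    (γ : GHom χ ψ) : P γ := by
  obtain ⟨γ, hγ⟩ := γ
  induction γ using Quotient.inductionOn with
  | h g => exact h g.1 g.2 hγ

lemma GHom.exists_mk {χ ψ : Omega S} (γ : GHom χ ψ) :
    ∃ (g : Hull S) (hg : χ g.dom = true) (h : χ.act g hg = ψ), γ = GHom.mk g hg h :=
  ⟨γ.1.out.1, γ.1.out.2, by
    have h : Germ.rng (χ := χ) (Quotient.mk (germSetoid χ) (Quotient.out γ.1)) = ψ := by
      rw [Quotient.out_eq]; exact γ.2
    exact h, Subtype.ext (Quotient.out_eq γ.1).symm⟩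

lemma GHom.mk_eq {χ ψ : Omega S} {g h : Hull S} {hg : χ g.dom = true} {hh : χ h.dom = true}
    {hg' : χ.act g hg = ψ} {hh' : χ.act h hh = ψ} :
    GHom.mk g hg hg' = GHom.mk h hh hh' ↔ ∃ Z, χ.BarOne Z ∧ ∀ s ∈ Z, g.1 s = h.1 s :=
  Subtype.ext_iff.trans Germ.mk_eq

/-- A representative `g` of the arrow `[g, χ]`. -/
def GHom.rep {χ ψ : Omega S} (γ : GHom χ ψ) : Hull S := (Quotient.out γ.1).1

lemma GHom.rep_dom {χ ψ : Omega S} (γ : GHom χ ψ) : χ γ.rep.dom = true := (Quotient.out γ.1).2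

lemma GHom.rep_act {χ ψ : Omega S} (γ : GHom χ ψ) : χ.act γ.rep γ.rep_dom = ψ := by
  have h : Germ.rng (χ := χ) (Quotient.mk (germSetoid χ) (Quotient.out γ.1)) = ψ := by
    rw [Quotient.out_eq]; exact γ.2
  exact h

lemma GHom.mk_rep {χ ψ : Omega S} (γ : GHom χ ψ) : GHom.mk γ.rep γ.rep_dom γ.rep_act = γ :=
  Subtype.ext (Quotient.out_eq γ.1)

lemma GHom.rep_mk {χ ψ : Omega S} (g : Hull S) (hg : χ g.dom = true) (h : χ.act g hg = ψ) :
    ∃ Z, χ.BarOne Z ∧ ∀ s ∈ Z, (GHom.mk g hg h).rep.1 s = g.1 s :=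
  GHom.mk_eq.1 (GHom.mk_rep (GHom.mk g hg h))

lemma GHom.comp_dom {χ ψ : Omega S} {g h : Hull S} (hg : χ g.dom = true) (hg' : χ.act g hg = ψ)
    (hh : ψ h.dom = true) : χ (h.mul g).dom = true := by
  subst hg'; exact Hull.dom_mul hg hh

lemma GHom.comp_act {χ ψ η : Omega S} {g h : Hull S} (hg : χ g.dom = true) (hg' : χ.act g hg = ψ)
    (hh : ψ h.dom = true) (hh' : ψ.act h hh = η) :
    χ.act (h.mul g) (GHom.comp_dom hg hg' hh) = η := by
  subst hg'; subst hh'; exact Omega.act_mul hg hh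

/-- The product `[h, ψ][g, χ] = [hg, χ]`, where `ψ = χ(g⁻¹ · g)`. It is defined using chosen
representatives and is independent of the choice by `GHom.comp_mk`. -/
def GHom.comp {χ ψ η : Omega S} (γ : GHom χ ψ) (δ : GHom ψ η) : GHom χ η :=
  GHom.mk (δ.rep.mul γ.rep) (GHom.comp_dom γ.rep_dom γ.rep_act δ.rep_dom)
    (GHom.comp_act γ.rep_dom γ.rep_act δ.rep_dom δ.rep_act)

lemma GHom.comp_mk {χ ψ η : Omega S} {g h : Hull S} (hg : χ g.dom = true) (hg' : χ.act g hg = ψ)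
    (hh : ψ h.dom = true) (hh' : ψ.act h hh = η) :
    (GHom.mk g hg hg').comp (GHom.mk h hh hh') =
      GHom.mk (h.mul g) (GHom.comp_dom hg hg' hh) (GHom.comp_act hg hg' hh hh') := by
  refine GHom.mk_eq.2 ?_
  obtain ⟨Z, hZ, hZ'⟩ := GHom.rep_mk g hg hg'
  obtain ⟨W, hW, hW'⟩ := GHom.rep_mk h hh hh'
  subst hg'
  refine ⟨_, hZ.inter (hW.preim hg), ?_⟩
  rintro s ⟨hs, t, ht, hst⟩
  change ((GHom.mk g hg rfl).rep.1.trans _) s = (g.1.trans h.1) s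
  change Option.bind _ _ = Option.bind _ _
  rw [show (GHom.mk g hg rfl).rep.1 s = g.1 s from hZ' s hs, hst]
  exact hW' t ht

lemma GHom.inv_dom {χ ψ : Omega S} {g : Hull S} (hg : χ g.dom = true) (hg' : χ.act g hg = ψ) :
    ψ g.inv.dom = true := by
  subst hg'; exact Hull.dom_inv hg

lemma GHom.inv_act {χ ψ : Omega S} {g : Hull S} (hg : χ g.dom = true) (hg' : χ.act g hg = ψ) :
    ψ.act g.inv (GHom.inv_dom hg hg') = χ := by
  subst hg'; exact Omega.act_inv hg

/-- The inverse `[g, χ]⁻¹ = [g⁻¹, χ(g⁻¹ · g)]`. -/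
def GHom.inv {χ ψ : Omega S} (γ : GHom χ ψ) : GHom ψ χ :=
  GHom.mk γ.rep.inv (GHom.inv_dom γ.rep_dom γ.rep_act) (GHom.inv_act γ.rep_dom γ.rep_act)

/-- The groupoid `𝒢(S)` with unit space `Ω(S)`. (In `γ ≫ δ` the arrow `γ` comes first, so this is
the product `δγ`.) -/
instance : Groupoid (Omega S) where
  Hom := GHom
  id χ := GHom.mk (Hull.of 1) χ.dom_one χ.act_one
  comp := GHom.comp
  inv := GHom.inv
  id_comp γ := by
    induction γ using GHom.ind with
    | h g hg h =>
      rw [GHom.comp_mk, GHom.mk_eq]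
      exact ⟨_, Omega.barOne_of hg, fun s _ => by simp [Hull.mul, Hull.of, PEquiv.trans]⟩
  comp_id γ := by
    induction γ using GHom.ind with
    | h g hg h =>
      rw [GHom.comp_mk, GHom.mk_eq]
      refine ⟨_, Omega.barOne_of hg, ?_⟩
      rintro s ⟨t, ht⟩
      simp [Hull.mul, Hull.of, PEquiv.trans, ht]
  assoc γ δ ε := by
    induction γ using GHom.ind with
    | h g hg h =>
    induction δ using GHom.ind with
    | h g' hg' h' =>
    induction ε using GHom.ind with
    | h g'' hg'' h'' =>
      simp only [GHom.comp_mk]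
      rw [GHom.mk_eq]
      exact ⟨_, Omega.barOne_of hg, fun s _ => by simp [Hull.mul, PEquiv.trans_assoc]⟩
  inv_comp {χ ψ} γ := by
    suffices h : GHom.comp γ.inv (GHom.mk γ.rep γ.rep_dom γ.rep_act) =
        GHom.mk (Hull.of 1) ψ.dom_one ψ.act_one by rwa [GHom.mk_rep] at h
    rw [GHom.inv, GHom.comp_mk, GHom.mk_eq]
    refine ⟨_, Omega.barOne_of (GHom.inv_dom γ.rep_dom γ.rep_act), fun s => ?_⟩
    rintro ⟨t, ht⟩
    have ht' := ht
    simp only [Hull.inv, PEquiv.eq_some_iff] at ht'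
    simp only [Hull.mul, Hull.of, leftTrans_apply, one_mul, PEquiv.trans_eq_some]
    exact ⟨t, ht, ht'⟩
  comp_inv {χ ψ} γ := by
    suffices h : GHom.comp (GHom.mk γ.rep γ.rep_dom γ.rep_act) γ.inv =
        GHom.mk (Hull.of 1) χ.dom_one χ.act_one by rwa [GHom.mk_rep] at h
    rw [GHom.inv, GHom.comp_mk, GHom.mk_eq]
    refine ⟨_, Omega.barOne_of γ.rep_dom, fun s => ?_⟩
    rintro ⟨t, ht⟩
    simp only [Hull.mul, Hull.of, Hull.inv, leftTrans_apply, one_mul, PEquiv.trans_eq_some,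
      PEquiv.eq_some_iff]
    exact ⟨t, ht, ht⟩

end Germs

section Topology

variable {S : Type*} [Monoid S] [IsLeftCancelMul S]

/-- The arrow `[g, χ]`, as an element of the set of arrows of `𝒢(S)`. -/
def germArr (g : Hull S) (χ : Omega S) (h : χ g.dom = true) : Arr (Omega S) :=
  ⟨χ, χ.act g h, GHom.mk g h rfl⟩

/-- The set `D(g, U) = {[g, χ] : χ ∈ U}`, where only the `χ` with `χ(g⁻¹g) = 1` contribute. -/
def D (g : Hull S) (U : Set (Omega S)) : Set (Arr (Omega S)) :=
  {γ | ∃ (χ : Omega S) (h : χ g.dom = true), χ ∈ U ∧ γ = germArr g χ h}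

/-- The topology on `𝒢(S)`: the sets `D(g, U)`, where `g ∈ I_ℓ(S)` and `U` is an open subset of
`{χ ∈ Ω(S) : χ(g⁻¹g) = 1}`, form a basis. -/
instance : TopologicalSpace (Arr (Omega S)) :=
  TopologicalSpace.generateFrom
    {W | ∃ (g : Hull S) (U : Set (Omega S)), IsOpen U ∧ (∀ χ ∈ U, χ g.dom = true) ∧ W = D g U}

lemma isClopen_eval (X : CIdeal S) : IsClopen {χ : Omega S | χ X = true} :=
  (isClopen_discrete {true}).preimage ((continuous_eval X).comp continuous_subtype_val)

lemma D_inter (g : Hull S) (U : Set (Omega S)) : D g U = D g (U ∩ {χ | χ g.dom = true}) := by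
  ext γ
  constructor
  · rintro ⟨χ, h, hU, rfl⟩; exact ⟨χ, h, ⟨hU, h⟩, rfl⟩
  · rintro ⟨χ, h, hU, rfl⟩; exact ⟨χ, h, hU.1, rfl⟩

lemma isOpen_D (g : Hull S) {U : Set (Omega S)} (hU : IsOpen U) : IsOpen (D g U) := by
  rw [D_inter]
  exact TopologicalSpace.isOpen_generateFrom_of_mem
    ⟨g, _, hU.inter (isClopen_eval g.dom).isOpen, fun _ h => h.2, rfl⟩

lemma exists_germArr (γ : Arr (Omega S)) : ∃ g h, γ = germArr g γ.src h := by
  obtain ⟨χ, ψ, γ⟩ := γ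
  obtain ⟨g, hg, rfl, rfl⟩ := GHom.exists_mk γ
  exact ⟨g, hg, rfl⟩

/-- The arrow `[g, χ]` as the pair of `χ` and the class. -/
def Arr.toSigma (γ : Arr (Omega S)) : Σ χ : Omega S, Germ χ :=
  ⟨γ.src, (show GHom γ.src γ.rng from γ.hom).1⟩

lemma germArr_eq {g h : Hull S} {χ : Omega S} {hg : χ g.dom = true} {hh : χ h.dom = true} :
    germArr g χ hg = germArr h χ hh ↔ ∃ Z, χ.BarOne Z ∧ ∀ s ∈ Z, g.1 s = h.1 s := by
  constructor
  · intro H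
    have H2 := congrArg Arr.toSigma H
    simp only [Arr.toSigma, germArr, Sigma.mk.injEq, heq_eq_eq, true_and] at H2
    exact Germ.mk_eq.1 H2
  · intro H
    have h1 : χ.act g hg = χ.act h hh := germRel.act_eq (g := ⟨g, hg⟩) (h := ⟨h, hh⟩) H
    have h2 : GHom.mk g hg h1 = GHom.mk h hh rfl := GHom.mk_eq.2 H
    have h3 : ∀ (ψ : Omega S) (h : χ.act g hg = ψ),
        germArr g χ hg = (⟨χ, ψ, GHom.mk g hg h⟩ : Arr (Omega S)) := by
      rintro _ rfl; rfl
    rw [h3 _ h1, h2]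
    rfl

lemma act_injective {g : Hull S} {χ ψ : Omega S} {h : χ g.dom = true} {h' : ψ g.dom = true}
    (H : χ.act g h = ψ.act g h') : χ = ψ := by
  have h1 := Omega.act_inv h
  have h2 := Omega.act_inv h'
  rw [← h1, ← h2]
  congr 1

instance : HasOpenBisections (Omega S) where
  exists_bisection γ := by
    obtain ⟨g, h, hγ⟩ := exists_germArr γ
    refine ⟨D g Set.univ, isOpen_D g isOpen_univ, ⟨_, h, trivial, hγ⟩, ?_, ?_⟩
    · rintro _ ⟨χ, h, -, rfl⟩ _ ⟨ψ, h', -, rfl⟩ (H : χ = ψ)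
      subst H; rfl
    · rintro _ ⟨χ, h, -, rfl⟩ _ ⟨ψ, h', -, rfl⟩ H
      obtain rfl : χ = ψ := act_injective (h := h) (h' := h') H
      rfl

instance : T2Space (Omega S) := inferInstanceAs (T2Space (Subtype _))

lemma isClosed_semiChar : IsClosed {χ : CIdeal S → Bool |
    (∃ X, χ X = true) ∧ ∀ X Y, χ (X.inter Y) = (χ X && χ Y)} := by
  have : {χ : CIdeal S → Bool | (∃ X, χ X = true) ∧ ∀ X Y, χ (X.inter Y) = (χ X && χ Y)} =
      {χ | χ (Hull.of (1 : S)).dom = true} ∩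
        ⋂ (X) (Y), {χ : CIdeal S → Bool | χ (X.inter Y) = (χ X && χ Y)} := by
    ext χ
    simp only [Set.mem_ofPred_eq, Set.mem_inter_iff, Set.mem_iInter]
    refine and_congr_left fun h => ⟨?_, fun h => ⟨_, h⟩⟩
    rintro ⟨X, hX⟩
    have h1 := h X (Hull.of (1 : S)).dom
    have h2 : X.inter (Hull.of (1 : S)).dom = X := by
      ext s
      simp [CIdeal.inter, Hull.dom, Hull.of]
    rw [h2, hX] at h1
    simpa using h1.symm
  rw [this]
  refine IsClosed.inter (isClosed_eq (continuous_apply _) continuous_const)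
    (isClosed_iInter fun X => isClosed_iInter fun Y => isClosed_eq (continuous_apply _) ?_)
  exact (continuous_of_discreteTopology (f := fun p : Bool × Bool => (p.1 && p.2))).comp
    (f := fun χ : CIdeal S → Bool => (χ X, χ Y)) ((continuous_apply X).prodMk (continuous_apply Y))

instance : CompactSpace (Omega S) := by
  have : CompactSpace (SemiChar S) := isCompact_iff_compactSpace.1 isClosed_semiChar.isCompact
  exact isCompact_iff_compactSpace.1 isClosed_closure.isCompact

lemma isOpen_barOne (Z : Set S) : IsOpen {χ : Omega S | χ.BarOne Z} := by
  have : {χ : Omega S | χ.BarOne Z} = ⋃ (X : CIdeal S) (F : Set (CIdeal S)) (_ : F.Finite)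
      (_ : Z = X.1 \ ⋃ Y ∈ F, Y.1), {χ | χ X = true} ∩ ⋂ Y ∈ F, {χ : Omega S | χ Y = true}ᶜ := by
    ext χ
    simp only [Omega.BarOne, Set.mem_ofPred_eq, Set.mem_iUnion, Set.mem_inter_iff, Set.mem_iInter,
      Set.mem_compl_iff, Bool.not_eq_true, exists_prop]
  rw [this]
  exact isOpen_iUnion fun X => isOpen_iUnion fun F => isOpen_iUnion fun hF => isOpen_iUnion fun _ =>
    (isClopen_eval X).isOpen.inter
      (hF.isOpen_biInter fun Y _ => (isClopen_eval Y).compl.isOpen)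

lemma continuous_germArr (g : Hull S) :
    Continuous fun χ : {χ : Omega S // χ g.dom = true} => germArr g χ.1 χ.2 := by
  refine continuous_generateFrom_iff.2 ?_
  rintro _ ⟨h, U, hU, -, rfl⟩
  have : (fun χ : {χ : Omega S // χ g.dom = true} => germArr g χ.1 χ.2) ⁻¹' D h U =
      Subtype.val ⁻¹' (U ∩ {χ | χ h.dom = true} ∩
        ⋃ (Z) (_ : ∀ s ∈ Z, g.1 s = h.1 s), {χ : Omega S | χ.BarOne Z}) := by
    ext ⟨χ, hχ⟩
    simp only [Set.mem_preimage, Set.mem_inter_iff, Set.mem_iUnion, Set.mem_ofPred_eq]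
    constructor
    · rintro ⟨ψ, hψ, hU, H⟩
      obtain rfl : χ = ψ := congrArg Arr.src H
      obtain ⟨Z, hZ, H⟩ := germArr_eq.1 H
      exact ⟨⟨hU, hψ⟩, Z, H, hZ⟩
    · rintro ⟨⟨hU, hψ⟩, Z, H, hZ⟩
      exact ⟨χ, hψ, hU, germArr_eq.2 ⟨Z, hZ, H⟩⟩
  rw [this]
  exact ((hU.inter (isClopen_eval _).isOpen).inter
    (isOpen_iUnion fun Z => isOpen_iUnion fun _ => isOpen_barOne Z)).preimage continuous_subtype_val

lemma continuous_src : Continuous (Arr.src : Arr (Omega S) → Omega S) := by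
  refine continuous_def.2 fun U hU => ?_
  have : (Arr.src : Arr (Omega S) → Omega S) ⁻¹' U = ⋃ g : Hull S, D g U := by
    ext γ
    simp only [Set.mem_preimage, Set.mem_iUnion]
    constructor
    · intro h
      obtain ⟨g, hg, H⟩ := exists_germArr γ
      exact ⟨g, γ.src, hg, h, H⟩
    · rintro ⟨g, χ, h, hU, rfl⟩
      exact hU
  rw [this]
  exact isOpen_iUnion fun g => isOpen_D g hU

lemma isBasicCc_indicator (g : Hull S) {U : Set (Omega S)} (hU : IsClopen U) :
    IsBasicCc (Omega S) ((D g U).indicator fun _ => 1) := by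
  refine ⟨D g U, isOpen_D g hU.isOpen, ?_, ?_, D g U, ?_, subset_rfl, ?_⟩
  · refine T2Space.of_injective_continuous (f := fun γ : D g U => γ.1.src) ?_
      (continuous_src.comp continuous_subtype_val)
    rintro ⟨_, χ, h, -, rfl⟩ ⟨_, ψ, h', -, rfl⟩ (H : χ = ψ)
    subst H; rfl
  · refine (continuousOn_const (c := (1 : ℂ))).congr fun γ hγ => ?_
    exact Set.indicator_of_mem hγ _
  · have : D g U = (fun χ : {χ : Omega S // χ g.dom = true} => germArr g χ.1 χ.2) ''
        (Subtype.val ⁻¹' U) := by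
      ext γ
      constructor
      · rintro ⟨χ, h, hU, rfl⟩; exact ⟨⟨χ, h⟩, hU, rfl⟩
      · rintro ⟨⟨χ, h⟩, hU, rfl⟩; exact ⟨χ, h, hU, rfl⟩
    rw [this]
    have hc : CompactSpace {χ : Omega S // χ g.dom = true} :=
      isCompact_iff_compactSpace.1 (isClopen_eval g.dom).isClosed.isCompact
    exact (hU.isClosed.preimage continuous_subtype_val).isCompact.image (continuous_germArr g)
  · exact fun γ hγ => Set.indicator_of_notMem hγ _

/-- The function `𝟙_{D(g, U)} ∈ C_c(𝒢(S))` for a clopen set `U ⊆ Ω(S)`. -/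
def indD (g : Hull S) (U : Set (Omega S)) (hU : IsClopen U) : Cc (Omega S) :=
  ⟨(D g U).indicator fun _ => 1, Submodule.subset_span (isBasicCc_indicator g hU)⟩

end Topology

section Regular

variable {S : Type*} [Monoid S] [IsLeftCancelMul S]

open scoped Classical in
lemma rowColBound_lam (s : S) :
    RowColBound (fun u t : S => if u = s * t then (1 : ℂ) else 0) 1 := by
  refine ⟨fun u F => ?_, fun t F => ?_⟩
  · by_cases h : ∃ t, u = s * t
    · obtain ⟨t, rfl⟩ := h
      simp only [mul_right_inj, apply_ite norm, norm_one, norm_zero]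
      rw [Finset.sum_ite_eq]
      split_ifs <;> simp
    · push Not at h
      simp [h]
  · simp only [apply_ite norm, norm_one, norm_zero]
    rw [Finset.sum_ite_eq']
    split_ifs <;> simp

open scoped Classical in
/-- The operator `λ_s` on `ℓ²(S)`, `λ_s δ_t = δ_{st}`, through its matrix
`(u, t) ↦ 1` if `u = st` and `0` otherwise. -/
def lam (s : S) : BEll2 S := kernelOp _ 1 (rowColBound_lam s)

open scoped Classical in
lemma lam_single (s t : S) :
    lam s (lp.single 2 t (1 : ℂ)) = lp.single 2 (s * t) (1 : ℂ) := by
  ext u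
  rw [lam, kernelOp_apply, tsum_eq_single t]
  · simp [Pi.single_apply]
  · intro v hv
    simp [hv]

variable (S) in
/-- The reduced C*-algebra `C*_r(S)`: the C*-algebra of operators on `ℓ²(S)` generated by the
`λ_s`, `s ∈ S`. -/
def MonoidCStar : NonUnitalStarSubalgebra ℂ (BEll2 S) :=
  (NonUnitalStarAlgebra.adjoin ℂ (Set.range (lam (S := S)))).topologicalClosure

lemma Hull.right_equivariant (g : Hull S) (s t u : S) (h : g.1 s = some u) :
    g.1 (s * t) = some (u * t) := by
  obtain ⟨g, hg⟩ := g
  simp only at h ⊢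
  induction hg generalizing s u with
  | of r =>
    simp only [leftTrans_apply, Option.some.injEq] at h ⊢
    rw [← h, mul_assoc]
  | inv _ ih =>
    rw [PEquiv.eq_some_iff] at h ⊢
    exact ih _ _ h
  | mul _ _ ih1 ih2 =>
    rw [PEquiv.trans_eq_some] at h ⊢
    obtain ⟨v, h1, h2⟩ := h
    exact ⟨v * t, ih2 _ _ h1, ih1 _ _ h2⟩

lemma Hull.dom_of (χ : Omega S) (s : S) : χ (Hull.of s).dom = true := by
  rw [← χ.dom_one]
  congr 1
  ext t
  simp [Hull.dom, Hull.of]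

/-- The arrow `[s, χ_e] ∈ 𝒢(S)_{χ_e}`. -/
def orbitArr (s : S) : SrcFiber (Omega.pt (1 : S)) :=
  ⟨(Omega.pt 1).act (Hull.of s) (Hull.dom_of _ s), GHom.mk (Hull.of s) (Hull.dom_of _ s) rfl⟩

lemma Omega.BarOne.mem_pt {s : S} {Z : Set S} (h : (Omega.pt s).BarOne Z) : s ∈ Z := by
  obtain ⟨X, F, -, rfl, hX, hF⟩ := h
  refine ⟨Omega.pt_eq_true.1 hX, ?_⟩
  simp only [Set.mem_iUnion, not_exists]
  intro Y hY hs
  rw [← Omega.pt_eq_true, hF Y hY] at hs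
  exact absurd hs (by simp)

lemma orbitArr_bijective : Function.Bijective (orbitArr (S := S)) := by
  constructor
  · intro s t h
    have h' : germArr (Hull.of s) (Omega.pt (1 : S)) (Hull.dom_of _ s) =
        germArr (Hull.of t) (Omega.pt (1 : S)) (Hull.dom_of _ t) :=
      congrArg (fun g : SrcFiber (Omega.pt (1 : S)) => (⟨_, g.1, g.2⟩ : Arr (Omega S))) h
    obtain ⟨Z, hZ, H⟩ := germArr_eq.1 h'
    simpa [Hull.of] using H 1 hZ.mem_pt
  · rintro ⟨ψ, γ⟩
    obtain ⟨g, hg, rfl, rfl⟩ := GHom.exists_mk γ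
    obtain ⟨s, hs⟩ : (1 : S) ∈ g.dom.1 := Omega.pt_eq_true.1 hg
    obtain rfl : g = Hull.of s := by
      refine Subtype.ext (PEquiv.ext fun t => ?_)
      have := g.right_equivariant 1 t s hs
      rw [one_mul] at this
      rw [this]
      rfl
    exact ⟨s, rfl⟩

variable (S) in
/-- The bijection `S → 𝒢(S)_{χ_e}`, `s ↦ [s, χ_e]`. -/
def orbitEquiv : S ≃ SrcFiber (Omega.pt (1 : S)) := Equiv.ofBijective orbitArr orbitArr_bijective

variable (S) in
/-- The representation `ρ_{χ_e}` of `C*_r(𝒢(S))`, viewed as a representation on `ℓ²(S)` by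
identifying `S` with `𝒢(S)_{χ_e}` by `s ↦ [s, χ_e]`. -/
def rhoE : ReducedCStar (Omega S) →⋆ₙₐ[ℂ] BEll2 S :=
  NonUnitalStarAlgHom.comp
    ((ell2Congr (orbitEquiv S)).symm.conjStarAlgEquiv : _ →⋆ₙₐ[ℂ] BEll2 S)
    (rho (Omega.pt (1 : S)))

end Regular

section Example

/-- The generators `a, b, c, x_n, y_n` (`n ∈ ℤ`). -/
inductive Gen
  | a | b | c
  | x (n : ℤ)
  | y (n : ℤ)

open FreeMonoid in
/-- The relations `abx_n = bx_n`, `aby_n = by_{n+1}`, `cbx_n = bx_{n+1}`, `cby_n = by_n`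
(`n ∈ ℤ`). -/
inductive TRel : FreeMonoid Gen → FreeMonoid Gen → Prop
  | abx (n : ℤ) : TRel (of .a * of .b * of (.x n)) (of .b * of (.x n))
  | aby (n : ℤ) : TRel (of .a * of .b * of (.y n)) (of .b * of (.y (n + 1)))
  | cbx (n : ℤ) : TRel (of .c * of .b * of (.x n)) (of .b * of (.x (n + 1)))
  | cby (n : ℤ) : TRel (of .c * of .b * of (.y n)) (of .b * of (.y n))

/-- The monoid `T`. -/
abbrev T : Type := PresentedMonoid TRel

/-- The generators, as elements of `T`. -/
abbrev T.gen (g : Gen) : T := PresentedMonoid.of TRel g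

/-- The right ideal `X = ⋃ₙ bx_nT ∪ ⋃ₙ by_nT` of `T`. -/
def T.idealX : Set T :=
  (⋃ n : ℤ, Set.range fun t : T => T.gen .b * T.gen (.x n) * t) ∪
    ⋃ n : ℤ, Set.range fun t : T => T.gen .b * T.gen (.y n) * t

end Example

end LeftCancelMonoidGpd

end

open GpdCStar LeftCancelMonoidGpd

/-!
Every point of `X = aT ∩ cT` is either fixed by `c`, or fixed by `a` together with its image under
`c`; so `(λ_a - 1)(λ_c - 1)` vanishes on `ℓ²(X)`. On the other hand, normal forms show that an
element of `I_ℓ(T)` maps the family of all `bxₙ`, `byₙ` to a family of the same kind or is defined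
on finitely many of its members only. Hence a constructible ideal contains all `bxₙ` and `byₙ` or
only finitely many of them, and the points `χ_{bxₙ}`, `χ_{byₙ}` accumulate at a character `χ` with
`χ(p_X) = 1` at which neither `a`, which moves all `byₙ`, nor `c`, which moves all `bxₙ`, has a
trivial germ. This contradicts C*-regularity, and it makes the coefficient of the element of the
kernel at the unit `χ` nonzero.

For every left cancellative `S`, functions in `C_c(𝒢(S))` are sums of functions supported in compact
open sets `D(g, U)`. The image of the latter under `ρ_{χ_e}` is the partial isometry given by `g`
times a diagonal operator with a symbol in `C(Ω(S))`, and these diagonal operators belong to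
`C*_r(S)` by the Stone–Weierstrass theorem.
-/

noncomputable section

open CategoryTheory

namespace GpdCStar

section Matrix

variable {ι κ : Type*}

open scoped Classical in
/-- The basis vector `δ_i` of `ℓ²(ι)`. -/
def delta (i : ι) : Ell2 ι := lp.single 2 i (1 : ℂ)

open scoped Classical in
lemma delta_apply (i j : ι) : delta i j = if j = i then 1 else 0 := by
  simp [delta, Pi.single_apply]

lemma delta_apply_self (i : ι) : delta i i = 1 := by
  simp [delta_apply]

lemma delta_apply_of_ne {i j : ι} (h : j ≠ i) : delta i j = 0 := by
  simp [delta_apply, h]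

lemma BEll2.ext_delta {A B : BEll2 ι} (h : ∀ i j, A (delta j) i = B (delta j) i) : A = B := by
  classical
  refine lp.ext_continuousLinearMap (by norm_num) fun j => ?_
  ext i
  exact h i j

lemma star_delta_apply (A : BEll2 ι) (i j : ι) : star A (delta j) i = star (A (delta i) j) := by
  classical
  have entry (ξ : Ell2 ι) (l : ι) : ξ l = inner ℂ (delta l) ξ := by
    simp [delta, lp.inner_single_left]
  rw [entry, entry (A (delta i)), ContinuousLinearMap.star_eq_adjoint,
    ContinuousLinearMap.adjoint_inner_right]
  exact (inner_conj_symm _ _).symm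

lemma kernelOp_delta {k : ι → ι → ℂ} {C : ℝ} (h : RowColBound k C) (i j : ι) :
    kernelOp k C h (delta j) i = k i j := by
  rw [kernelOp_apply, tsum_eq_single j fun l hl => by rw [delta_apply_of_ne hl, mul_zero],
    delta_apply_self, mul_one]

lemma ell2Congr_delta (e : ι ≃ κ) (i : ι) : ell2Congr e (delta i) = delta (e i) := by
  classical
  ext j
  change delta i (e.symm j) = delta (e i) j
  simp [delta_apply, e.symm_apply_eq]

end Matrix

section PartialBijection

variable {ι : Type*}

lemma sum_norm_ite_le_one (s : Finset ι) {p : ι → Prop} [DecidablePred p]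
    (hp : ∀ i j, p i → p j → i = j) : ∑ i ∈ s, ‖if p i then (1 : ℂ) else 0‖ ≤ 1 := by
  simp only [apply_ite norm, norm_one, norm_zero, Finset.sum_boole]
  exact_mod_cast Finset.card_le_one.2 fun i hi j hj =>
    hp i j (Finset.mem_filter.1 hi).2 (Finset.mem_filter.1 hj).2

open scoped Classical in
lemma rowColBound_pequiv (g : ι ≃. ι) :
    RowColBound (fun i j => if g j = some i then (1 : ℂ) else 0) 1 :=
  ⟨fun _ s => sum_norm_ite_le_one s fun _ _ hj hl => g.inj hj hl,
    fun _ s => sum_norm_ite_le_one s fun _ _ hi hl => Option.some.inj (hi.symm.trans hl)⟩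

open scoped Classical in
/-- The partial isometry of `ℓ²(ι)` defined by a partial bijection `g` of `ι`: it maps `δ_j` to
`δ_{g j}` if `g j` is defined and to `0` otherwise. -/
def ofPEquiv (g : ι ≃. ι) : BEll2 ι :=
  kernelOp _ 1 (rowColBound_pequiv g)

open scoped Classical in
lemma ofPEquiv_delta_apply (g : ι ≃. ι) (i j : ι) :
    ofPEquiv g (delta j) i = if g j = some i then 1 else 0 :=
  kernelOp_delta _ i j

lemma ofPEquiv_delta_some {g : ι ≃. ι} {i j : ι} (h : g j = some i) :
    ofPEquiv g (delta j) = delta i := by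
  classical
  ext l
  simp [ofPEquiv_delta_apply, delta_apply, h, eq_comm]

lemma ofPEquiv_delta_none {g : ι ≃. ι} {j : ι} (h : g j = none) : ofPEquiv g (delta j) = 0 := by
  ext l
  simp [ofPEquiv_delta_apply, h]

lemma ofPEquiv_symm (g : ι ≃. ι) : ofPEquiv g.symm = star (ofPEquiv g) := by
  classical
  refine BEll2.ext_delta fun i j => ?_
  simp only [star_delta_apply, ofPEquiv_delta_apply, PEquiv.eq_some_iff]
  split_ifs <;> simp

lemma ofPEquiv_trans (h g : ι ≃. ι) : ofPEquiv (h.trans g) = ofPEquiv g * ofPEquiv h := by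
  classical
  refine BEll2.ext_delta fun i j => ?_
  have trans_apply : (h.trans g) j = (h j).bind g := rfl
  rw [mul_apply_eq_comp]
  cases hj : h j with
  | none => simp [ofPEquiv_delta_none, trans_apply, hj]
  | some l => simp [ofPEquiv_delta_some hj, ofPEquiv_delta_apply, trans_apply, hj]

end PartialBijection

section Diagonal

variable {ι Y : Type*} [TopologicalSpace Y] [CompactSpace Y]

open scoped Classical in
lemma rowColBound_diag (p : ι → Y) (F : C(Y, ℂ)) :
    RowColBound (fun i j => if i = j then F (p i) else 0) ‖F‖ := by
  constructor <;> intro i s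
  all_goals
    simp only [apply_ite norm, norm_zero, Finset.sum_ite_eq, Finset.sum_ite_eq']
    split_ifs
    exacts [F.norm_coe_le_norm _, norm_nonneg F]

open scoped Classical in
/-- The diagonal operator `δ_i ↦ F(p i) δ_i` on `ℓ²(ι)`. -/
def diagOp (p : ι → Y) (F : C(Y, ℂ)) : BEll2 ι :=
  kernelOp _ ‖F‖ (rowColBound_diag p F)

lemma diagOp_apply (p : ι → Y) (F : C(Y, ℂ)) (ξ : Ell2 ι) (i : ι) :
    diagOp p F ξ i = F (p i) * ξ i := by
  rw [diagOp, kernelOp_apply, tsum_eq_single i fun j hj => by simp [hj.symm], if_pos rfl]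

/-- The representation of `C(Y)` on `ℓ²(ι)` by the diagonal operators `δ_i ↦ F(p i) δ_i`. -/
def diagHom (p : ι → Y) : C(Y, ℂ) →⋆ₐ[ℂ] BEll2 ι where
  toFun := diagOp p
  map_one' := by ext ξ i; simp [diagOp_apply]
  map_mul' F G := by ext ξ i; simp [diagOp_apply, mul_assoc]
  map_zero' := by ext ξ i; simp [diagOp_apply]
  map_add' F G := by ext ξ i; simp [diagOp_apply, add_mul]
  commutes' c := by ext ξ i; simp [diagOp_apply, Algebra.algebraMap_eq_smul_one]
  map_star' F := BEll2.ext_delta fun i j => by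
    by_cases h : i = j
    · simp [star_delta_apply, diagOp_apply, h, delta_apply_self]
    · simp [star_delta_apply, diagOp_apply, delta_apply_of_ne, h, Ne.symm h]

lemma diagHom_apply (p : ι → Y) (F : C(Y, ℂ)) (ξ : Ell2 ι) (i : ι) :
    diagHom p F ξ i = F (p i) * ξ i :=
  diagOp_apply p F ξ i

lemma diagHom_delta (p : ι → Y) (F : C(Y, ℂ)) (i : ι) :
    diagHom p F (delta i) = F (p i) • delta i := by
  classical
  ext j
  by_cases h : j = i <;> simp [diagHom_apply, delta_apply, h]

end Diagonal

section RegularRepresentation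

variable {X : Type*} [Groupoid X]

/-- The arrow `g k⁻¹` for `g, k ∈ 𝒢ₓ`. -/
def divArr {x : X} (g k : SrcFiber x) : Arr X := ⟨k.1, g.1, Groupoid.inv k.2 ≫ g.2⟩

lemma regOp_delta [TopologicalSpace (Arr X)] [HasOpenBisections X] (f : Cc X) (x : X)
    (g k : SrcFiber x) : regOp f x (delta k) g = f.1 (divArr g k) :=
  kernelOp_delta _ g k

end RegularRepresentation

end GpdCStar

namespace LeftCancelMonoidGpd

section TrivialGerms

open Filter Topology

variable {S : Type*} [Monoid S] [IsLeftCancelMul S]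

/-- The germ `[g, χ]` is the unit at `χ`: the partial bijection `g` is the identity on some
`Z ∈ 𝒥̄(S)` with `χ(p_Z) = 1`. -/
def Hull.IsTrivialAt (g : Hull S) (χ : Omega S) : Prop :=
  ∃ Z, χ.BarOne Z ∧ ∀ s ∈ Z, g.1 s = some s

lemma Omega.mem_sdiff_iff {χ : Omega S} {s : S} {X : CIdeal S} {F : Set (CIdeal S)}
    (hX : χ X = pt s X) (hF : ∀ Y ∈ F, χ Y = pt s Y) :
    s ∈ X.1 \ ⋃ Y ∈ F, Y.1 ↔ χ X = true ∧ ∀ Y ∈ F, χ Y = false := by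
  rw [hX, pt_eq_true, Set.mem_sdiff]
  refine and_congr_right fun _ => ?_
  simp only [Set.mem_iUnion, exists_prop, not_exists, not_and, ← pt_eq_true, Bool.not_eq_true]
  exact forall₂_congr fun Y hY => by rw [hF Y hY]

lemma Omega.BarOne.exists_of_subset_iUnion {χ : Omega S} {X : Set S} (hX : χ.BarOne X)
    {ι : Type*} [Finite ι] {Y : ι → Set S} (hY : ∀ j, IsBarConstructible S (Y j))
    (h : X ⊆ ⋃ j, Y j) : ∃ j, χ.BarOne (Y j) := by
  obtain ⟨A, F, hF, rfl, hA⟩ := hX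
  choose B G hG hYB using hY
  obtain ⟨s, hs⟩ := χ.exists_pt (F := insert A F ∪ ⋃ j, insert (B j) (G j))
    ((hF.insert A).union (Set.finite_iUnion fun j => (hG j).insert (B j)))
  have hsB (j : ι) : ∀ Z ∈ insert (B j) (G j), χ Z = pt s Z := fun Z hZ =>
    hs Z (.inr (Set.mem_iUnion_of_mem j hZ))
  have s_mem : s ∈ A.1 \ ⋃ Z ∈ F, Z.1 :=
    (mem_sdiff_iff (hs A (.inl (.inl rfl))) fun Z hZ => hs Z (.inl (.inr hZ))).2 hA
  obtain ⟨j, hj⟩ := Set.mem_iUnion.1 (h s_mem)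
  rw [hYB j, mem_sdiff_iff (hsB j _ (.inl rfl)) fun Z hZ => hsB j Z (.inr hZ)] at hj
  exact ⟨j, B j, G j, hG j, hYB j, hj⟩

lemma Omega.BarOne.nonempty {χ : Omega S} {X : Set S} (hX : χ.BarOne X) : X.Nonempty := by
  by_contra h
  obtain ⟨j, -⟩ := hX.exists_of_subset_iUnion (Y := fun _ : Empty => ∅) (fun j => j.elim)
    (by simp [Set.not_nonempty_iff_eq_empty.1 h])
  exact j.elim

theorem IsCStarRegular.exists_isTrivialAt (hS : IsCStarRegular S) {n : ℕ} {h : Fin n → Hull S}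
    {χ : Omega S} {X : Set S} (hX : χ.BarOne X) (hXh : X ⊆ ⋃ k, {s | (h k).1 s = some s}) :
    ∃ k, (h k).IsTrivialAt χ := by
  have hX' : IsBarConstructible S X := by
    obtain ⟨A, F, hF, hA, -⟩ := hX
    exact ⟨A, F, hF, hA⟩
  obtain ⟨l, Y, κ, hY, hXY, hYκ⟩ := hS n h X hX' hX.nonempty hXh
  obtain ⟨j, hj⟩ := hX.exists_of_subset_iUnion hY hXY
  exact ⟨κ j, Y j, hj, hYκ j⟩

/-- Every constructible ideal contains all members of the family `f` or only finitely many. If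
the index set is infinite, the points `χ_{f i}` then converge in `Ω(S)` along the cofinite
filter. -/
def AllOrFinite {ι : Type*} (f : ι → S) : Prop :=
  ∀ Z : CIdeal S, (∀ i, f i ∈ Z.1) ∨ {i | f i ∈ Z.1}.Finite

variable {ι : Type*} {f : ι → S}

theorem AllOrFinite.exists_limit [Infinite ι] (hf : AllOrFinite f) :
    ∃ χ : Omega S, ∀ Z, χ Z = true ↔ ∀ i, f i ∈ Z.1 := by
  let u : Ultrafilter (Omega S) := (hyperfilter ι).map fun i => Omega.pt (f i)
  obtain ⟨χ, -, hχ⟩ := isCompact_univ.ultrafilter_le_nhds u (by simp)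
  have eventually_iff (Z : CIdeal S) :
      χ Z = true ↔ ∀ᶠ i in (hyperfilter ι : Filter ι), f i ∈ Z.1 := by
    have mem_iff : {ψ : Omega S | ψ Z = true} ∈ u ↔
        ∀ᶠ i in (hyperfilter ι : Filter ι), f i ∈ Z.1 := by
      simp [u, Omega.pt_eq_true, Filter.Eventually]
    rw [← mem_iff]
    refine ⟨fun h => hχ ((isClopen_eval Z).isOpen.mem_nhds h), fun h => ?_⟩
    by_contra hZ
    exact Ultrafilter.compl_mem_iff_notMem.1 (hχ ((isClopen_eval Z).compl.isOpen.mem_nhds hZ)) h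
  refine ⟨χ, fun Z => (eventually_iff Z).trans ⟨fun h => ?_, .of_forall⟩⟩
  exact (hf Z).resolve_right fun hZ => Set.Finite.notMem_hyperfilter hZ h

lemma AllOrFinite.finite_notMem (hf : AllOrFinite f) {χ : Omega S}
    (hχ : ∀ Z, χ Z = true ↔ ∀ i, f i ∈ Z.1) {Z : Set S} (hZ : χ.BarOne Z) :
    {i | f i ∉ Z}.Finite := by
  obtain ⟨X, F, hF, rfl, hX, hF0⟩ := hZ
  have finite_mem (Y : CIdeal S) (hY : Y ∈ F) : {i | f i ∈ Y.1}.Finite :=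
    (hf Y).resolve_left fun h => absurd (hF0 Y hY) (by simp [(hχ Y).2 h])
  refine (hF.biUnion finite_mem).subset fun i hi => ?_
  simpa [(hχ X).1 hX i] using hi

lemma AllOrFinite.not_isTrivialAt (hf : AllOrFinite f) {χ : Omega S}
    (hχ : ∀ Z, χ Z = true ↔ ∀ i, f i ∈ Z.1) {g : Hull S}
    (hg : {i | g.1 (f i) ≠ some (f i)}.Infinite) : ¬ g.IsTrivialAt χ :=
  fun ⟨_, hZ, hgZ⟩ => hg ((hf.finite_notMem hχ hZ).subset fun _ hi hiZ => hi (hgZ _ hiZ))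

end TrivialGerms

section Fiber

variable {S : Type*} [Monoid S] [IsLeftCancelMul S]

/-- The arrow `[g, χ]` as an element of the source fibre `𝒢(S)_χ`. -/
def fiberGerm (χ : Omega S) (g : Hull S) (hg : χ g.dom = true) : SrcFiber χ :=
  ⟨χ.act g hg, GHom.mk g hg rfl⟩

variable {χ : Omega S} {g h : Hull S}

lemma fiberGerm_eq_iff {hg : χ g.dom = true} {hh : χ h.dom = true} :
    fiberGerm χ g hg = fiberGerm χ h hh ↔ ∃ Z, χ.BarOne Z ∧ ∀ s ∈ Z, g.1 s = h.1 s := by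
  rw [← germArr_eq (hg := hg) (hh := hh), germArr, germArr, Arr.mk.injEq, fiberGerm, fiberGerm,
    Sigma.mk.injEq, eq_self_iff_true, true_and]

lemma fiberGerm_eq_mk (hg : χ g.dom = true) {ψ : Omega S} (h : χ.act g hg = ψ) :
    fiberGerm χ g hg = ⟨ψ, GHom.mk g hg h⟩ := by
  subst h; rfl

lemma fiberGerm_mul (hh : χ h.dom = true) (hg : χ.act h hh g.dom = true) :
    fiberGerm χ (g.mul h) (Hull.dom_mul hh hg) =
      ⟨(χ.act h hh).act g hg, (fiberGerm χ h hh).2 ≫ (fiberGerm (χ.act h hh) g hg).2⟩ :=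
  (fiberGerm_eq_mk _ _).trans (congrArg (Sigma.mk _) (GHom.comp_mk hh rfl hg rfl).symm)

lemma divArr_fiberGerm_mem_D_iff {l : SrcFiber χ} {hh : χ h.dom = true} {U : Set (Omega S)} :
    divArr l (fiberGerm χ h hh) ∈ D g U ↔ χ.act h hh ∈ U ∧
      ∃ hg : χ.act h hh g.dom = true, l = fiberGerm χ (g.mul h) (Hull.dom_mul hh hg) := by
  constructor
  · obtain ⟨ψ, γ⟩ := l
    rintro ⟨η, hη, hU, H⟩
    obtain rfl : χ.act h hh = η := congrArg Arr.src H
    obtain rfl : ψ = (χ.act h hh).act g hη := congrArg Arr.rng H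
    have hγ : Groupoid.inv (fiberGerm χ h hh).2 ≫ γ = (fiberGerm (χ.act h hh) g hη).2 :=
      eq_of_heq ((Arr.mk.injEq ..).mp H).2.2
    refine ⟨hU, hη, ?_⟩
    rw [fiberGerm_mul hh hη, ← hγ]
    simp
  · rintro ⟨hU, hg, rfl⟩
    refine ⟨_, hg, hU, ?_⟩
    rw [fiberGerm_mul hh hg]
    simp [divArr, germArr, fiberGerm]

lemma coe_indD (g : Hull S) (U : Set (Omega S)) (hU : IsClopen U) :
    (indD g U hU).1 = (D g U).indicator fun _ => 1 :=
  rfl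

lemma regOp_indD_delta {U : Set (Omega S)} {hU : IsClopen U} {hh : χ h.dom = true}
    (hχU : χ.act h hh ∈ U) (hg : χ.act h hh g.dom = true) :
    regOp (indD g U hU) χ (delta (fiberGerm χ h hh)) =
      delta (fiberGerm χ (g.mul h) (Hull.dom_mul hh hg)) := by
  classical
  ext l
  simp [regOp_delta, delta_apply, coe_indD, Set.indicator_apply, divArr_fiberGerm_mem_D_iff, hχU,
    hg]

lemma fst_orbitArr (t : S) : (orbitArr t).1 = Omega.pt t := by
  ext X
  rw [Bool.eq_iff_iff, Omega.pt_eq_true]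
  change Omega.pt 1 ((Hull.of t).preim X) = true ↔ _
  rw [Omega.pt_eq_true]
  simp [Hull.preim, Hull.of]

/-- The arrow `[s, χ_e] [t, χ_e]⁻¹`. -/
def orbitDiv (s t : S) : Arr (Omega S) := divArr (orbitArr s) (orbitArr t)

lemma orbitDiv_mem_D_iff {U : Set (Omega S)} {s t : S} :
    orbitDiv s t ∈ D g U ↔ Omega.pt t ∈ U ∧ g.1 t = some s := by
  have fst_mem : (orbitArr t).1 ∈ U ↔ Omega.pt t ∈ U := by rw [fst_orbitArr]
  refine divArr_fiberGerm_mem_D_iff.trans (and_congr fst_mem ?_)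
  constructor
  · rintro ⟨hg, H⟩
    obtain ⟨Z, hZ, hst⟩ := fiberGerm_eq_iff.1 H
    simpa [Hull.of, Hull.mul, PEquiv.trans] using (hst 1 hZ.mem_pt).symm
  · intro hst
    have hg : Omega.pt t g.dom = true := Omega.pt_eq_true.2 ⟨s, hst⟩
    refine ⟨by rwa [← fst_orbitArr] at hg, fiberGerm_eq_iff.2
      ⟨_, Omega.barOne_of (Omega.dom_one _), fun r _ => ?_⟩⟩
    simpa [Hull.of, Hull.mul, PEquiv.trans] using (g.right_equivariant t r s hst).symm

lemma rhoE_toReduced_delta (f : Cc (Omega S)) (s t : S) :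
    rhoE S (toReduced f) (delta t) s = f.1 (orbitDiv s t) := by
  change regOp f (Omega.pt 1) (ell2Congr (orbitEquiv S) (delta t)) (orbitEquiv S s) = _
  rw [ell2Congr_delta, regOp_delta]
  rfl

lemma rhoE_indD_delta_of_mem {U : Set (Omega S)} {hU : IsClopen U} {t u : S} (ht : Omega.pt t ∈ U)
    (hg : g.1 t = some u) : rhoE S (toReduced (indD g U hU)) (delta t) = delta u := by
  classical
  ext s
  rw [rhoE_toReduced_delta, delta_apply, coe_indD, Set.indicator_apply]
  exact if_congr (orbitDiv_mem_D_iff.trans (by simp [ht, hg, eq_comm])) rfl rfl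

lemma rhoE_indD_delta_of_notMem {U : Set (Omega S)} {hU : IsClopen U} {t : S}
    (ht : Omega.pt t ∉ U) : rhoE S (toReduced (indD g U hU)) (delta t) = 0 := by
  ext s
  rw [rhoE_toReduced_delta, coe_indD,
    Set.indicator_of_notMem fun h => ht (orbitDiv_mem_D_iff.1 h).1]
  rfl

end Fiber

section MonoidCStar

variable {S : Type*} [Monoid S] [IsLeftCancelMul S]

lemma lam_delta (s t : S) : lam s (delta t) = delta (s * t) :=
  lam_single s t

lemma ofPEquiv_leftTrans (s : S) : ofPEquiv (leftTrans s) = lam s :=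
  BEll2.ext_delta fun u t => by rw [lam_delta, ofPEquiv_delta_some (leftTrans_apply s t)]

lemma isClosed_monoidCStar : IsClosed (MonoidCStar S : Set (BEll2 S)) :=
  NonUnitalStarSubalgebra.isClosed_topologicalClosure _

lemma lam_mem_monoidCStar (s : S) : lam s ∈ MonoidCStar S :=
  NonUnitalStarSubalgebra.le_topologicalClosure _
    (NonUnitalStarAlgebra.subset_adjoin ℂ _ (Set.mem_range_self s))

lemma InHull.ofPEquiv_mem {g : S ≃. S} (hg : InHull S g) : ofPEquiv g ∈ MonoidCStar S := by
  induction hg with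
  | of s => exact ofPEquiv_leftTrans s ▸ lam_mem_monoidCStar s
  | inv _ ih => exact ofPEquiv_symm _ ▸ star_mem ih
  | mul _ _ ih₁ ih₂ => exact ofPEquiv_trans _ _ ▸ mul_mem ih₁ ih₂

lemma one_mem_monoidCStar : (1 : BEll2 S) ∈ MonoidCStar S := by
  have lam_one : lam (1 : S) = 1 := BEll2.ext_delta fun s t => by simp [lam_delta]
  exact lam_one ▸ lam_mem_monoidCStar 1

open scoped Classical in
lemma diagHom_charFn_eval (X : CIdeal S) :
    diagHom Omega.pt (LocallyConstant.charFn ℂ (isClopen_eval X) : C(Omega S, ℂ)) =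
      ofPEquiv (PEquiv.ofSet X.1) := by
  refine BEll2.ext_delta fun s t => ?_
  by_cases hst : s = t
  · simp [hst, diagHom_apply, ofPEquiv_delta_apply, delta_apply_self, LocallyConstant.coe_charFn,
      Set.indicator_apply, Omega.pt_eq_true]
  · simp [diagHom_apply, ofPEquiv_delta_apply, delta_apply_of_ne hst, hst]

open scoped CStarAlgebra in
theorem diagHom_pt_mem (F : C(Omega S, ℂ)) : diagHom Omega.pt F ∈ MonoidCStar S := by
  let Φ : C(Omega S, ℂ) →⋆ₐ[ℂ] BEll2 S := diagHom Omega.pt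
  have one_mem : Φ 1 ∈ MonoidCStar S := by
    rw [map_one]
    exact one_mem_monoidCStar
  let A : StarSubalgebra ℂ C(Omega S, ℂ) := ((MonoidCStar S).comap Φ).toStarSubalgebra one_mem
  have hA : IsClosed (A : Set C(Omega S, ℂ)) := isClosed_monoidCStar.preimage (map_continuous Φ)
  have charFn_mem (X : CIdeal S) :
      (LocallyConstant.charFn ℂ (isClopen_eval X) : C(Omega S, ℂ)) ∈ A := by
    change Φ _ ∈ MonoidCStar S
    exact diagHom_charFn_eval X ▸ InHull.ofPEquiv_mem X.2
  have separates : A.toSubalgebra.SeparatesPoints := fun χ ψ hχψ => by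
    obtain ⟨X, hX⟩ : ∃ X, χ X ≠ ψ X := by
      contrapose! hχψ
      exact Omega.ext hχψ
    refine ⟨_, ⟨_, charFn_mem X, rfl⟩, ?_⟩
    cases hχ : χ X <;> cases hψ : ψ X <;>
      simp_all [LocallyConstant.coe_charFn]
  have A_eq_top : A = ⊤ := by
    rw [← ContinuousMap.starSubalgebra_topologicalClosure_eq_top_of_separatesPoints A separates]
    exact le_antisymm A.le_topologicalClosure (A.topologicalClosure_minimal le_rfl hA)
  have F_mem : F ∈ A := A_eq_top ▸ StarSubalgebra.mem_top
  exact F_mem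

end MonoidCStar

end LeftCancelMonoidGpd

namespace GpdCStar

section ContinuousOnCompactOpen

variable {X E : Type*} [TopologicalSpace X] [TopologicalSpace E] {V : Set X} [T2Space V]

lemma continuousOn_indicator_compl [Zero E] {A : Set X} {f : X → E} (hf : ContinuousOn f V)
    (hAV : A ⊆ V) (hAc : IsCompact A) (hAo : IsOpen A) : ContinuousOn (Aᶜ.indicator f) V := by
  have isCompact_preimage : IsCompact (Subtype.val ⁻¹' A : Set V) :=
    (Topology.IsInducing.subtypeVal.isCompact_preimage_iff (by simpa using hAV)).2 hAc
  have isClopen_preimage : IsClopen (Subtype.val ⁻¹' A : Set V) :=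
    ⟨isCompact_preimage.isClosed, hAo.preimage continuous_subtype_val⟩
  rw [continuousOn_iff_continuous_domRestrict] at hf ⊢
  exact hf.indicator (s := (Subtype.val ⁻¹' A)ᶜ) (by simp [isClopen_preimage.compl.frontier_eq])

lemma indicator_biUnion_mem [AddCommMonoid E] {M : AddSubmonoid (X → E)} {ι : Type*}
    {B : ι → Set X} (hBV : ∀ i, B i ⊆ V) (hBc : ∀ i, IsCompact (B i)) (hBo : ∀ i, IsOpen (B i))
    (hBM : ∀ i f, ContinuousOn f (B i) → (B i).indicator f ∈ M) (I : Finset ι) {f : X → E}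
    (hf : ContinuousOn f V) : (⋃ i ∈ I, B i).indicator f ∈ M := by
  classical
  induction I using Finset.induction_on generalizing f with
  | empty =>
    simp only [Finset.notMem_empty, Set.iUnion_of_empty, Set.iUnion_empty, Set.indicator_empty']
    exact M.zero_mem
  | insert i I _ ih =>
    have split : (⋃ j ∈ insert i I, B j).indicator f =
        (B i).indicator f + (⋃ j ∈ I, B j).indicator ((B i)ᶜ.indicator f) := by
      rw [Finset.set_biUnion_insert, Set.indicator_indicator, Set.inter_comm,
        ← Set.sdiff_eq_compl_inter, ← Set.union_sdiff_self]
      exact Set.indicator_union_of_disjoint Set.disjoint_sdiff_right f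
    rw [split]
    exact add_mem (hBM i f (hf.mono (hBV i)))
      (ih (continuousOn_indicator_compl hf (hBV i) (hBc i) (hBo i)))

end ContinuousOnCompactOpen

end GpdCStar

namespace LeftCancelMonoidGpd

section RegularRepresentation

variable {S : Type*} [Monoid S] [IsLeftCancelMul S]

instance : TotallyDisconnectedSpace (Omega S) :=
  inferInstanceAs (TotallyDisconnectedSpace (Subtype _))

lemma D_eq_image (g : Hull S) (U : Set (Omega S)) :
    D g U = (fun χ : {χ : Omega S // χ g.dom = true} => germArr g χ.1 χ.2) ''
      (Subtype.val ⁻¹' U) := by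
  ext γ
  constructor
  · rintro ⟨χ, hχ, hU, rfl⟩
    exact ⟨⟨χ, hχ⟩, hU, rfl⟩
  · rintro ⟨⟨χ, hχ⟩, hU, rfl⟩
    exact ⟨χ, hχ, hU, rfl⟩

lemma isCompact_D (g : Hull S) {U : Set (Omega S)} (hU : IsClosed U) : IsCompact (D g U) := by
  have : CompactSpace {χ : Omega S // χ g.dom = true} :=
    isCompact_iff_compactSpace.1 (isClopen_eval g.dom).isClosed.isCompact
  rw [D_eq_image]
  exact (hU.preimage continuous_subtype_val).isCompact.image (continuous_germArr g)

lemma exists_isClopen_D_subset {V : Set (Arr (Omega S))} (hV : IsOpen V) {γ : Arr (Omega S)}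
    (hγ : γ ∈ V) : ∃ g U, IsClopen U ∧ D g U ⊆ V ∧ γ ∈ D g U := by
  obtain ⟨g, h, hγg⟩ := exists_germArr γ
  have isOpen_germ_mem : IsOpen (Subtype.val '' ((fun χ : {χ : Omega S // χ g.dom = true} =>
      germArr g χ.1 χ.2) ⁻¹' V)) :=
    (isClopen_eval g.dom).isOpen.isOpenMap_subtype_val _ (hV.preimage (continuous_germArr g))
  obtain ⟨U, hU, hγU, hUV⟩ := compact_exists_isClopen_in_isOpen isOpen_germ_mem (x := γ.src)
    ⟨⟨γ.src, h⟩, by rwa [Set.mem_preimage, ← hγg], rfl⟩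
  refine ⟨g, U, hU, ?_, γ.src, h, hγU, hγg⟩
  rintro _ ⟨χ, -, hχ, rfl⟩
  obtain ⟨⟨χ, _⟩, hχV, rfl⟩ := hUV hχ
  exact hχV

variable (S) in
/-- The functions `f` on `𝒢(S)` for which the matrix `(f([s, χ_e] [t, χ_e]⁻¹))_{s, t}` is that of an
operator in `C*_r(S)`. For `f ∈ C_c(𝒢(S))` it is the matrix of `ρ_{χ_e}(f)`. -/
def orbitRepresentable : Submodule ℂ (Arr (Omega S) → ℂ) where
  carrier := {f | ∃ A ∈ MonoidCStar S, ∀ s t, A (delta t) s = f (orbitDiv s t)}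
  zero_mem' := ⟨0, zero_mem _, fun _ _ => rfl⟩
  add_mem' := by
    rintro f f' ⟨A, hA, hAf⟩ ⟨A', hA', hAf'⟩
    exact ⟨A + A', add_mem hA hA', fun s t => by simp [hAf, hAf']⟩
  smul_mem' := by
    rintro c f ⟨A, hA, hAf⟩
    exact ⟨c • A, SMulMemClass.smul_mem c hA, fun s t => by simp [hAf]⟩

lemma orbitDiv_eq_germArr {g : Hull S} {s t : S} (hg : g.1 t = some s) :
    orbitDiv s t = germArr g (Omega.pt t) (Omega.pt_eq_true.2 ⟨s, hg⟩) := by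
  obtain ⟨χ, hχ, -, hst⟩ := orbitDiv_mem_D_iff.2 ⟨Set.mem_univ (Omega.pt t), hg⟩
  obtain rfl : Omega.pt t = χ := (fst_orbitArr t).symm.trans (congrArg Arr.src hst)
  exact hst

lemma exists_continuous_extension {g : Hull S} {U : Set (Omega S)} (hU : IsClopen U)
    {f : Arr (Omega S) → ℂ} (hf : ContinuousOn f (D g U)) :
    ∃ F : C(Omega S, ℂ), (∀ χ ∈ U, ∀ hχ : χ g.dom = true, F χ = f (germArr g χ hχ)) ∧
      ∀ χ ∉ U, F χ = 0 := by
  let W : Set (Omega S) := {χ | χ g.dom = true} ∩ U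
  have hW : IsClopen W := (isClopen_eval g.dom).inter hU
  have : CompactSpace W := isCompact_iff_compactSpace.1 hW.isClosed.isCompact
  let φ : W → ℂ := fun χ => f (germArr g χ.1 χ.2.1)
  have hφ : Continuous φ :=
    hf.comp_continuous ((continuous_germArr g).comp (continuous_inclusion Set.inter_subset_left))
      fun χ => ⟨χ.1, χ.2.1, χ.2.2, rfl⟩
  refine ⟨⟨Function.extend Subtype.val φ 0,
    (HasCompactSupport.of_compactSpace φ).continuous_extend_zero hW.isOpen hφ⟩,
    fun χ hχU hχ => Subtype.val_injective.extend_apply φ _ (⟨χ, hχ, hχU⟩ : W),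
    fun χ hχU => Function.extend_apply' φ _ χ ?_⟩
  rintro ⟨χ, rfl⟩
  exact hχU χ.2.2

lemma indicator_D_mem_orbitRepresentable {g : Hull S} {U : Set (Omega S)} (hU : IsClopen U)
    {f : Arr (Omega S) → ℂ} (hf : ContinuousOn f (D g U)) :
    (D g U).indicator f ∈ orbitRepresentable S := by
  classical
  obtain ⟨F, hFU, hF0⟩ := exists_continuous_extension hU hf
  refine ⟨ofPEquiv g.1 * diagHom Omega.pt F, mul_mem (InHull.ofPEquiv_mem g.2) (diagHom_pt_mem F),
    fun s t => ?_⟩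
  rw [mul_apply_eq_comp, diagHom_delta, map_smul, lp.coeFn_smul, Pi.smul_apply,
    ofPEquiv_delta_apply, Set.indicator_apply]
  by_cases hg : g.1 t = some s
  · by_cases ht : Omega.pt t ∈ U
    · rw [if_pos hg, if_pos (orbitDiv_mem_D_iff.2 ⟨ht, hg⟩), orbitDiv_eq_germArr hg, ← hFU _ ht,
        smul_eq_mul, mul_one]
    · simp [hg, ht, hF0, orbitDiv_mem_D_iff]
  · simp [hg, orbitDiv_mem_D_iff]

theorem Cc_le_orbitRepresentable : Cc (Omega S) ≤ orbitRepresentable S := by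
  refine Submodule.span_le.2 ?_
  rintro f ⟨V, hV, _, hf, K, hK, hKV, hf0⟩
  choose g U hU hUV hmem using fun γ : V => exists_isClopen_D_subset hV γ.2
  obtain ⟨I, hI⟩ := hK.elim_finite_subcover (fun γ => D (g γ) (U γ))
    (fun γ => isOpen_D _ (hU γ).isOpen)
    fun γ hγ => Set.mem_iUnion.2 ⟨⟨γ, hKV hγ⟩, hmem ⟨γ, hKV hγ⟩⟩
  have f_eq : (⋃ γ ∈ I, D (g γ) (U γ)).indicator f = f :=
    Set.indicator_eq_self.2 fun γ hγ => hI (not_imp_comm.1 (hf0 γ) hγ)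
  rw [← f_eq]
  exact indicator_biUnion_mem (M := (orbitRepresentable S).toAddSubmonoid) hUV
    (fun γ => isCompact_D _ (hU γ).isClosed) (fun γ => isOpen_D _ (hU γ).isOpen)
    (fun γ _ => indicator_D_mem_orbitRepresentable (hU γ)) I hf

lemma rhoE_toReduced_mem (f : Cc (Omega S)) : rhoE S (toReduced f) ∈ MonoidCStar S := by
  obtain ⟨A, hA, hAf⟩ := Cc_le_orbitRepresentable f.2
  have rhoE_eq : rhoE S (toReduced f) = A :=
    BEll2.ext_delta fun s t => by rw [rhoE_toReduced_delta, hAf]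
  exact rhoE_eq ▸ hA

open scoped CStarAlgebra in
theorem rhoE_mem (z : ReducedCStar (Omega S)) : rhoE S z ∈ MonoidCStar S := by
  let Φ : RegAmbient (Omega S) →⋆ₙₐ[ℂ] BEll2 S :=
    ((ell2Congr (orbitEquiv S)).symm.conjStarAlgEquiv : _ →⋆ₙₐ[ℂ] BEll2 S).comp
      (RegAmbient.eval (Omega S) (Omega.pt 1))
  have le_comap : ReducedCStar (Omega S) ≤ (MonoidCStar S).comap Φ := by
    refine NonUnitalStarSubalgebra.topologicalClosure_minimal _ (NonUnitalStarAlgebra.adjoin_le ?_)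
      (isClosed_monoidCStar.preimage (map_continuous Φ))
    rintro _ ⟨f, rfl⟩
    exact rhoE_toReduced_mem f
  exact le_comap z.2

variable (S) in
/-- The homomorphism `ρ_{χ_e} : C*_r(𝒢(S)) → C*_r(S)`. -/
def regularHom : ReducedCStar (Omega S) →⋆ₙₐ[ℂ] MonoidCStar S :=
  NonUnitalStarAlgHom.codRestrict (rhoE S) (MonoidCStar S) rhoE_mem

end RegularRepresentation

section KernelElement

variable {S : Type*} [Monoid S] [IsLeftCancelMul S]

/-- The element `(𝟙_{D(s, Ω)} - 𝟙_Ω) * (𝟙_{D(t, Ω)} - 𝟙_Ω) * 𝟙_U` of `C*_r(𝒢(S))`, where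
`U = {η ∈ Ω(S) : η(p_X) = 1}`. -/
def kernelElement (s t : S) (X : CIdeal S) : ReducedCStar (Omega S) :=
  (toReduced (indD (Hull.of s) Set.univ isClopen_univ)
      - toReduced (indD (Hull.of 1) Set.univ isClopen_univ))
    * (toReduced (indD (Hull.of t) Set.univ isClopen_univ)
      - toReduced (indD (Hull.of 1) Set.univ isClopen_univ))
    * toReduced (indD (Hull.of 1) {η : Omega S | η X = true} (isClopen_eval X))

lemma rhoE_indD_of_univ_delta (s t : S) :
    rhoE S (toReduced (indD (Hull.of s) Set.univ isClopen_univ)) (delta t) = delta (s * t) :=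
  rhoE_indD_delta_of_mem (Set.mem_univ _) (leftTrans_apply s t)

theorem rhoE_kernelElement_eq_zero {s t : S} {X : CIdeal S}
    (h : ∀ u ∈ X.1, (s * u = u ∧ s * (t * u) = t * u) ∨ t * u = u) :
    rhoE S (kernelElement s t X) = 0 := by
  refine BEll2.ext_delta fun v u => ?_
  rw [kernelElement, map_mul, map_mul, map_sub, map_sub, mul_apply_eq_comp, mul_apply_eq_comp]
  by_cases hu : u ∈ X.1
  · rw [rhoE_indD_delta_of_mem (Omega.pt_eq_true.2 hu) (leftTrans_apply 1 u), one_mul]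
    simp only [sub_apply, map_sub, rhoE_indD_of_univ_delta, one_mul]
    obtain ⟨hs, hst⟩ | ht := h u hu
    · simp [hs, hst]
    · simp [ht]
  · rw [rhoE_indD_delta_of_notMem (mt Omega.pt_eq_true.1 hu), map_zero, map_zero, zero_apply]

lemma leftTrans_mul (s t : S) : leftTrans (s * t) = (leftTrans t).trans (leftTrans s) :=
  PEquiv.ext fun u => congrArg some (mul_assoc s t u)

lemma Hull.of_mul_of (s t : S) : (Hull.of s).mul (Hull.of t) = Hull.of (s * t) :=
  Subtype.ext (leftTrans_mul s t).symm

lemma regOp_indD_of_delta {χ : Omega S} {U : Set (Omega S)} {hU : IsClopen U} {s t : S}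
    (ht : χ.act (Hull.of t) (Hull.dom_of χ t) ∈ U) :
    regOp (indD (Hull.of s) U hU) χ (delta (fiberGerm χ (Hull.of t) (Hull.dom_of χ t))) =
      delta (fiberGerm χ (Hull.of (s * t)) (Hull.dom_of χ (s * t))) := by
  rw [regOp_indD_delta ht (Hull.dom_of _ s)]
  congr! 2
  exact Hull.of_mul_of s t

lemma fiberGerm_of_ne_one {χ : Omega S} {s : S} (hs : ¬ (Hull.of s).IsTrivialAt χ) :
    fiberGerm χ (Hull.of s) (Hull.dom_of χ s) ≠ fiberGerm χ (Hull.of 1) (Hull.dom_of χ 1) := by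
  refine fun H => hs ?_
  obtain ⟨Z, hZ, hs1⟩ := fiberGerm_eq_iff.1 H
  exact ⟨Z, hZ, fun u hu => (hs1 u hu).trans (by simp [Hull.of])⟩

theorem kernelElement_ne_zero {s t : S} {X : CIdeal S} {χ : Omega S} (hX : χ X = true)
    (hs : ¬ (Hull.of s).IsTrivialAt χ) (ht : ¬ (Hull.of t).IsTrivialAt χ) :
    kernelElement s t X ≠ 0 := by
  intro H
  let germ (r : S) : SrcFiber χ := fiberGerm χ (Hull.of r) (Hull.dom_of χ r)
  have apply_one : rho χ (kernelElement s t X) (delta (germ 1)) =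
      delta (germ (s * t)) - delta (germ t) - (delta (germ s) - delta (germ 1)) := by
    have hU : χ.act (Hull.of 1) (Hull.dom_of χ 1) ∈ {η : Omega S | η X = true} := by
      rwa [χ.act_one]
    simp only [kernelElement, map_mul, map_sub, rho_toReduced, mul_apply_eq_comp, sub_apply, germ,
      regOp_indD_of_delta hU, regOp_indD_of_delta (Set.mem_univ _), one_mul, mul_one]
  have coeff_one : (0 : ℂ) = delta (germ (s * t)) (germ 1) + 1 := by
    have := congrArg (fun ξ => ξ (germ 1)) apply_one
    simpa [H, delta_apply_self, delta_apply_of_ne (fiberGerm_of_ne_one hs).symm,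
      delta_apply_of_ne (fiberGerm_of_ne_one ht).symm, germ] using this
  rw [delta_apply] at coeff_one
  split_ifs at coeff_one <;> norm_num at coeff_one

end KernelElement

section NormalForm

/-- Left multiplication by a generator on the normal forms of the elements of `T`: the words without
subwords `abxₙ`, `abyₙ`, `cbxₙ`, `cbyₙ`. -/
def Gen.act : Gen → List Gen → List Gen
  | .a, .b :: .x n :: w => .b :: .x n :: w
  | .a, .b :: .y n :: w => .b :: .y (n + 1) :: w
  | .c, .b :: .x n :: w => .b :: .x (n + 1) :: w
  | .c, .b :: .y n :: w => .b :: .y n :: w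
  | g, w => g :: w

lemma Gen.act_injective (g : Gen) : Function.Injective g.act := by
  intro v w h
  unfold Gen.act at h
  split at h <;> split at h <;> grind

/-- The generators `xₙ` and `yₙ`. -/
def Gen.xy : ℤ ⊕ ℤ → Gen := Sum.elim .x .y

lemma Gen.xy_injective : Function.Injective Gen.xy := by
  rintro (m | m) (n | n) h <;> simp_all [Gen.xy]

/-- The permutation `bxₙ ↦ bxₙ`, `byₙ ↦ byₙ₊₁` of the indices, induced by `a`. -/
def shiftY : Equiv.Perm (ℤ ⊕ ℤ) := (Equiv.refl ℤ).sumCongr (Equiv.addRight 1)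

/-- The permutation `bxₙ ↦ bxₙ₊₁`, `byₙ ↦ byₙ` of the indices, induced by `c`. -/
def shiftX : Equiv.Perm (ℤ ⊕ ℤ) := (Equiv.addRight 1).sumCongr (Equiv.refl ℤ)

lemma Gen.a_act (z : ℤ ⊕ ℤ) (w : List Gen) : a.act (b :: xy z :: w) = b :: xy (shiftY z) :: w := by
  cases z <;> rfl

lemma Gen.c_act (z : ℤ ⊕ ℤ) (w : List Gen) : c.act (b :: xy z :: w) = b :: xy (shiftX z) :: w := by
  cases z <;> rfl

lemma Gen.exists_of_act_c_eq_act_a {v w : List Gen} (h : c.act v = a.act w) :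
    ∃ z u, a.act w = b :: xy z :: u := by
  unfold Gen.act at h ⊢
  split at h <;> split at h <;> simp_all [xy]

/-- The action of `T` on words extending `Gen.act`. -/
def T.actHom : T →* Function.End (List Gen) :=
  PresentedMonoid.lift (M := Function.End (List Gen)) Gen.act fun u v h => by cases h <;> rfl

/-- The normal form of an element of `T`. -/
def T.nf (t : T) : List Gen := T.actHom t []

lemma T.nf_one : T.nf 1 = [] := by
  rw [T.nf, map_one]
  rfl

lemma T.nf_gen_mul (g : Gen) (t : T) : T.nf (T.gen g * t) = g.act (T.nf t) := by
  rw [T.nf, map_mul]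
  rfl

lemma T.nf_gen (g : Gen) : T.nf (T.gen g) = [g] := by
  rw [← mul_one (T.gen g), T.nf_gen_mul, T.nf_one]
  cases g <;> rfl

lemma T.induction {P : T → Prop} (one : P 1) (mul : ∀ g t, P t → P (T.gen g * t)) (t : T) :
    P t := by
  induction t using PresentedMonoid.inductionOn with
  | h w =>
    induction w using FreeMonoid.inductionOn' with
    | one => exact one
    | of_mul g w ih => exact mul g _ ih

/-- The elements `bxₙ` and `byₙ` of `T`. -/
def T.bxy (z : ℤ ⊕ ℤ) : T := T.gen .b * T.gen (.xy z)

lemma T.a_mul_bxy (z : ℤ ⊕ ℤ) : T.gen .a * T.bxy z = T.bxy (shiftY z) := by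
  rw [T.bxy, ← mul_assoc]
  obtain n | n := z
  · exact PresentedMonoid.mk_eq_mk_of_rel (.abx n)
  · exact PresentedMonoid.mk_eq_mk_of_rel (.aby n)

lemma T.c_mul_bxy (z : ℤ ⊕ ℤ) : T.gen .c * T.bxy z = T.bxy (shiftX z) := by
  rw [T.bxy, ← mul_assoc]
  obtain n | n := z
  · exact PresentedMonoid.mk_eq_mk_of_rel (.cbx n)
  · exact PresentedMonoid.mk_eq_mk_of_rel (.cby n)

/-- The element of `T` defined by a word. -/
def T.ofWord (w : List Gen) : T := (w.map T.gen).prod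

lemma T.ofWord_cons (g : Gen) (w : List Gen) : T.ofWord (g :: w) = T.gen g * T.ofWord w := by
  simp [T.ofWord]

lemma T.ofWord_b_xy (z : ℤ ⊕ ℤ) (w : List Gen) :
    T.ofWord (.b :: .xy z :: w) = T.bxy z * T.ofWord w := by
  rw [T.ofWord_cons, T.ofWord_cons, ← mul_assoc, T.bxy]

lemma T.ofWord_a_act (z : ℤ ⊕ ℤ) (w : List Gen) :
    T.ofWord (.b :: .xy (shiftY z) :: w) = T.gen .a * T.ofWord (.b :: .xy z :: w) := by
  rw [T.ofWord_b_xy, T.ofWord_b_xy, ← mul_assoc, T.a_mul_bxy]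

lemma T.ofWord_c_act (z : ℤ ⊕ ℤ) (w : List Gen) :
    T.ofWord (.b :: .xy (shiftX z) :: w) = T.gen .c * T.ofWord (.b :: .xy z :: w) := by
  rw [T.ofWord_b_xy, T.ofWord_b_xy, ← mul_assoc, T.c_mul_bxy]

lemma T.ofWord_act (g : Gen) (w : List Gen) : T.ofWord (g.act w) = T.gen g * T.ofWord w := by
  unfold Gen.act
  split
  · exact T.ofWord_a_act (.inl _) _
  · exact T.ofWord_a_act (.inr _) _
  · exact T.ofWord_c_act (.inl _) _
  · exact T.ofWord_c_act (.inr _) _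
  · exact T.ofWord_cons _ _

lemma T.ofWord_nf (t : T) : T.ofWord (T.nf t) = t := by
  induction t using T.induction with
  | one => rw [T.nf_one]; rfl
  | mul g t ih => rw [T.nf_gen_mul, T.ofWord_act, ih]

lemma T.nf_injective : Function.Injective T.nf :=
  Function.LeftInverse.injective T.ofWord_nf

theorem T.isLeftCancelMul : IsLeftCancelMul T where
  mul_left_cancel s := by
    induction s using T.induction with
    | one => exact fun t u h => by simpa using h
    | mul g s ih =>
      refine fun t u (h : T.gen g * s * t = T.gen g * s * u) =>
        ih (T.nf_injective (g.act_injective ?_))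
      rw [← T.nf_gen_mul, ← T.nf_gen_mul, ← mul_assoc, h, mul_assoc]

lemma T.nf_ofWord_of_act {g : Gen} {w : List Gen} {t : T} (h : T.nf t = g.act w) :
    T.nf (T.ofWord w) = w :=
  g.act_injective (by rw [← T.nf_gen_mul, ← T.ofWord_act, ← h, T.ofWord_nf])

lemma T.nf_bxy (z : ℤ ⊕ ℤ) : T.nf (T.bxy z) = [.b, .xy z] := by
  rw [T.bxy, T.nf_gen_mul, T.nf_gen]
  rfl

lemma T.bxy_injective : Function.Injective T.bxy := fun z z' h => by
  have := congrArg T.nf h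
  simp only [T.nf_bxy, List.cons.injEq, and_true, true_and] at this
  exact Gen.xy_injective this

lemma T.mem_idealX {t : T} : t ∈ T.idealX ↔ ∃ z u, T.bxy z * u = t := by
  simp only [T.idealX, Set.mem_union, Set.mem_iUnion, Set.mem_range, Sum.exists]
  rfl

lemma T.mem_idealX_iff_dvd {t : T} : t ∈ T.idealX ↔ T.gen .a ∣ t ∧ T.gen .c ∣ t := by
  rw [T.mem_idealX]
  constructor
  · rintro ⟨z, u, rfl⟩
    refine ⟨⟨T.bxy (shiftY.symm z) * u, ?_⟩, ⟨T.bxy (shiftX.symm z) * u, ?_⟩⟩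
    · rw [← mul_assoc, T.a_mul_bxy, Equiv.apply_symm_apply]
    · rw [← mul_assoc, T.c_mul_bxy, Equiv.apply_symm_apply]
  · rintro ⟨⟨u, rfl⟩, v, h⟩
    have nf_eq := congrArg T.nf h.symm
    rw [T.nf_gen_mul, T.nf_gen_mul] at nf_eq
    obtain ⟨z, w, hw⟩ := Gen.exists_of_act_c_eq_act_a nf_eq
    exact ⟨z, T.ofWord w, by rw [← T.ofWord_b_xy, ← hw, ← T.nf_gen_mul, T.ofWord_nf]⟩

lemma T.mul_eq_of_mem_idealX {t : T} (ht : t ∈ T.idealX) :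
    T.gen .a * t = t ∧ T.gen .a * (T.gen .c * t) = T.gen .c * t ∨ T.gen .c * t = t := by
  obtain ⟨n | n, u, rfl⟩ := T.mem_idealX.1 ht
  · exact .inl (by simp only [← mul_assoc (T.gen _), T.a_mul_bxy, T.c_mul_bxy]; exact ⟨rfl, rfl⟩)
  · exact .inr (by rw [← mul_assoc, T.c_mul_bxy]; rfl)

end NormalForm

section Families

lemma Gen.act_append {g : Gen} {w : List Gen} (h : ¬ (w = [b] ∧ (g = a ∨ g = c))) (s : Gen) :
    g.act (w ++ [s]) = g.act w ++ [s] := by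
  match w with
  | [] => cases g <;> cases s <;> rfl
  | [k] => cases g <;> cases k <;> simp_all [Gen.act]
  | k :: l :: w => cases g <;> cases k <;> cases l <;> rfl

lemma Gen.exists_act_append_xy (g : Gen) (w : List Gen) :
    ∃ w' : List Gen, ∃ σ : Equiv.Perm (ℤ ⊕ ℤ), ∀ z, g.act (w ++ [xy z]) = w' ++ [xy (σ z)] := by
  by_cases h : w = [b] ∧ (g = a ∨ g = c)
  · obtain ⟨rfl, rfl | rfl⟩ := h
    · exact ⟨[b], shiftY, fun z => a_act z []⟩
    · exact ⟨[b], shiftX, fun z => c_act z []⟩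
  · exact ⟨g.act w, 1, fun z => act_append h _⟩

lemma Gen.exists_xy_of_act_append {g s : Gen} {v w : List Gen} {z : ℤ ⊕ ℤ}
    (h : g.act (v ++ [s]) = w ++ [xy z]) : ∃ z', s = xy z' := by
  by_cases hv : v = [b] ∧ (g = a ∨ g = c)
  · cases s with
    | x n => exact ⟨.inl n, rfl⟩
    | y n => exact ⟨.inr n, rfl⟩
    | _ =>
      have last_eq := congrArg List.getLast? h
      obtain ⟨rfl, rfl | rfl⟩ := hv <;> cases z <;> simp [act, xy] at last_eq
  · rw [act_append hv] at h
    exact ⟨z, by simpa using (List.append_inj' h rfl).2⟩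

lemma Gen.append_xy_mem_range_act (g : Gen) (w : List Gen) :
    (∃ v : List Gen, ∃ σ : Equiv.Perm (ℤ ⊕ ℤ), ∀ z, g.act (v ++ [xy (σ z)]) = w ++ [xy z]) ∨
      {z | w ++ [xy z] ∈ Set.range g.act}.Finite := by
  by_cases H : ∃ v s z, g.act (v ++ [s]) = w ++ [xy z]
  · obtain ⟨v, s, z, h⟩ := H
    obtain ⟨z', rfl⟩ := exists_xy_of_act_append h
    obtain ⟨w', σ, hσ⟩ := g.exists_act_append_xy v
    obtain rfl : w' = w := (List.append_inj' ((hσ z').symm.trans h) rfl).1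
    exact .inl ⟨v, σ.symm, fun z => by rw [hσ, Equiv.apply_symm_apply]⟩
  · have act_nil {z} (hz : w ++ [xy z] ∈ Set.range g.act) : w ++ [xy z] = [g] := by
      obtain ⟨u, hu⟩ := hz
      obtain rfl | ⟨v, s, rfl⟩ := u.eq_nil_or_concat'
      · rw [← hu]
        cases g <;> rfl
      · exact absurd ⟨v, s, z, hu⟩ H
    refine .inr (Set.Subsingleton.finite fun z hz z' hz' => xy_injective ?_)
    simpa using (act_nil hz).trans (act_nil hz').symm

/-- The families `(txₙ, tyₙ)ₙ` in `T` up to permutations of the indices, through their normal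
forms. -/
def T.IsFamily (f : ℤ ⊕ ℤ → T) : Prop :=
  ∃ w : List Gen, ∃ σ : Equiv.Perm (ℤ ⊕ ℤ), ∀ z, T.nf (f z) = w ++ [.xy (σ z)]

/-- A partial bijection respects families if it sends every family to a family or is defined on
finitely many of its members only. -/
def T.RespectsFamilies (g : T ≃. T) : Prop :=
  ∀ f, T.IsFamily f →
    (∃ f', T.IsFamily f' ∧ ∀ z, g (f z) = some (f' z)) ∨ {z | (g (f z)).isSome}.Finite

lemma T.RespectsFamilies.trans {g h : T ≃. T} (hg : T.RespectsFamilies g)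
    (hh : T.RespectsFamilies h) : T.RespectsFamilies (g.trans h) := by
  intro f hf
  have trans_apply (s : T) : (g.trans h) s = (g s).bind h := rfl
  obtain ⟨f', hf', hgf⟩ | hgf := hg f hf
  · simp only [trans_apply, hgf, Option.bind_some]
    exact hh f' hf'
  · exact .inr (hgf.subset fun z => Option.isSome_of_isSome_bind)

attribute [local instance] T.isLeftCancelMul

lemma T.respectsFamilies_leftTrans_gen (g : Gen) :
    T.RespectsFamilies (leftTrans (T.gen g)) := by
  rintro f ⟨w, σ, hf⟩
  obtain ⟨w', τ, h⟩ := g.exists_act_append_xy w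
  exact .inl ⟨fun z => T.gen g * f z, ⟨w', σ.trans τ, fun z => by rw [T.nf_gen_mul, hf, h]; rfl⟩,
    fun z => rfl⟩

lemma T.respectsFamilies_symm_leftTrans_gen (g : Gen) :
    T.RespectsFamilies (leftTrans (T.gen g)).symm := by
  rintro f ⟨w, σ, hf⟩
  obtain ⟨v, τ, h⟩ | h := g.append_xy_mem_range_act w
  · have nf_eq (z) : T.nf (f z) = g.act (v ++ [.xy (τ (σ z))]) := (hf z).trans (h (σ z)).symm
    refine .inl ⟨fun z => T.ofWord (v ++ [.xy (τ (σ z))]),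
      ⟨v, σ.trans τ, fun z => T.nf_ofWord_of_act (nf_eq z)⟩, fun z => ?_⟩
    rw [PEquiv.eq_some_iff, leftTrans_apply, ← T.ofWord_act, ← nf_eq, T.ofWord_nf]
  · refine .inr ((h.preimage σ.injective.injOn).subset fun z hz => ?_)
    obtain ⟨t, ht⟩ := Option.isSome_iff_exists.1 hz
    rw [PEquiv.eq_some_iff, leftTrans_apply, Option.some.injEq] at ht
    exact ⟨T.nf t, by rw [← T.nf_gen_mul, ht, hf]⟩

lemma T.respectsFamilies_leftTrans (s : T) :
    T.RespectsFamilies (leftTrans s) ∧ T.RespectsFamilies (leftTrans s).symm := by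
  induction s using T.induction with
  | one =>
    have leftTrans_one : leftTrans (1 : T) = PEquiv.refl T :=
      PEquiv.ext fun u => congrArg some (one_mul u)
    rw [leftTrans_one, PEquiv.symm_refl, and_self]
    exact fun f hf => .inl ⟨f, hf, fun z => rfl⟩
  | mul g s ih =>
    rw [leftTrans_mul, PEquiv.symm_trans_rev]
    exact ⟨ih.1.trans (T.respectsFamilies_leftTrans_gen g),
      (T.respectsFamilies_symm_leftTrans_gen g).trans ih.2⟩

lemma InHull.respectsFamilies {g : T ≃. T} (hg : InHull T g) :
    T.RespectsFamilies g ∧ T.RespectsFamilies g.symm := by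
  induction hg with
  | of s => exact T.respectsFamilies_leftTrans s
  | inv _ ih => exact ⟨ih.2, ih.1⟩
  | mul _ _ ih1 ih2 =>
    rw [PEquiv.symm_trans_rev]
    exact ⟨ih2.1.trans ih1.1, ih1.2.trans ih2.2⟩

theorem T.allOrFinite_bxy : AllOrFinite T.bxy := by
  classical
  intro Z
  obtain ⟨f, -, h⟩ | h := (InHull.respectsFamilies Z.2).1 T.bxy ⟨[.b], 1, T.nf_bxy⟩
  · refine .inl fun z => ?_
    obtain ⟨hz, hZ⟩ := PEquiv.ofSet_eq_some_iff.1 (h z)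
    exact hz ▸ hZ
  · refine .inr (h.subset fun z hz => ?_)
    exact Option.isSome_iff_exists.2 ⟨T.bxy z, PEquiv.ofSet_eq_some_iff.2 ⟨rfl, hz⟩⟩

end Families

section Example

attribute [local instance] T.isLeftCancelMul

open scoped Classical in
theorem T.isConstructible_idealX : IsConstructible T T.idealX := by
  refine IsConstructible.of_inHull
    (.mul (.mul (.of (T.gen .a)) (.inv (.of (T.gen .a))))
      (.mul (.of (T.gen .c)) (.inv (.of (T.gen .c))))) _ fun s t => ?_
  simp only [PEquiv.trans_eq_some, PEquiv.eq_some_iff, leftTrans_apply, Option.some.injEq,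
    T.mem_idealX_iff_dvd, dvd_def]
  grind

theorem T.exists_nontrivial_germs : ∃ χ : Omega T,
    χ ⟨T.idealX, T.isConstructible_idealX⟩ = true ∧
      ¬ (Hull.of (T.gen .a)).IsTrivialAt χ ∧ ¬ (Hull.of (T.gen .c)).IsTrivialAt χ := by
  obtain ⟨χ, hχ⟩ := T.allOrFinite_bxy.exists_limit
  refine ⟨χ, (hχ _).2 fun z => T.mem_idealX.2 ⟨z, 1, mul_one _⟩,
    T.allOrFinite_bxy.not_isTrivialAt hχ
      ((Set.infinite_range_of_injective Sum.inr_injective).mono ?_),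
    T.allOrFinite_bxy.not_isTrivialAt hχ
      ((Set.infinite_range_of_injective Sum.inl_injective).mono ?_)⟩
  · rintro _ ⟨n, rfl⟩ h
    have : T.bxy (shiftY (.inr n)) = T.bxy (.inr n) :=
      (T.a_mul_bxy _).symm.trans (Option.some.inj h)
    simpa [shiftY] using T.bxy_injective this
  · rintro _ ⟨n, rfl⟩ h
    have : T.bxy (shiftX (.inl n)) = T.bxy (.inl n) :=
      (T.c_mul_bxy _).symm.trans (Option.some.inj h)
    simpa [shiftX] using T.bxy_injective this

theorem T.not_isCStarRegular : ¬ IsCStarRegular T := by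
  intro H
  obtain ⟨χ, hX, ha, hc⟩ := T.exists_nontrivial_germs
  obtain ⟨k, hk⟩ := H.exists_isTrivialAt (h := ![Hull.of (T.gen .a), Hull.of (T.gen .c)])
    (Omega.barOne_of hX) fun t ht => Set.mem_iUnion.2 <| by
      obtain h | h := T.mul_eq_of_mem_idealX ht
      · exact ⟨0, congrArg some h.1⟩
      · exact ⟨1, congrArg some h⟩
  fin_cases k
  exacts [ha hk, hc hk]

end Example

end LeftCancelMonoidGpd

end

theorem proposition3p2 :
    ∃ _ : IsLeftCancelMul T,
      ¬ IsCStarRegular T ∧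
      ∃ (hX : IsConstructible T T.idealX)
        (φ : ReducedCStar (Omega T) →⋆ₙₐ[ℂ] MonoidCStar T),
        (∀ z, (φ z : BEll2 T) = rhoE T z) ∧
        ∃ z : ReducedCStar (Omega T),
          z = (toReduced (indD (Hull.of (T.gen .a)) Set.univ isClopen_univ)
                - toReduced (indD (Hull.of 1) Set.univ isClopen_univ))
              * (toReduced (indD (Hull.of (T.gen .c)) Set.univ isClopen_univ)
                - toReduced (indD (Hull.of 1) Set.univ isClopen_univ))
              * toReduced (indD (Hull.of 1) {η : Omega T | η ⟨T.idealX, hX⟩ = true}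
                  (isClopen_eval ⟨T.idealX, hX⟩)) ∧
          z ≠ 0 ∧ φ z = 0 := by
  have := T.isLeftCancelMul
  obtain ⟨χ, hX, ha, hc⟩ := T.exists_nontrivial_germs
  exact ⟨T.isLeftCancelMul, T.not_isCStarRegular, T.isConstructible_idealX, regularHom T,
    fun _ => rfl, kernelElement (T.gen .a) (T.gen .c) ⟨T.idealX, T.isConstructible_idealX⟩, rfl,
    kernelElement_ne_zero hX ha hc,
    Subtype.ext (rhoE_kernelElement_eq_zero fun _ => T.mul_eq_of_mem_idealX)⟩
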